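/- \textbf{Setting.} Let $p\in(0,1)$, $q=1-p$, let $(E,\mathcal B)$ be a measurable space (for instance a subset of $\mathbb R$ with its Borel sets) with a $\sigma$-finite measure $\mu$, and let $f^0_x(y)$, $f^1_x(y)$ be two jointly measurable functions with values in $[0,\infty)$ such that $\int_E f^i_x(y)\,\mu(dy)=1$ for all $x\in E$, $i=0,1$; they are the transition densities of two homogeneous Markov processes. Assume that for every $x$, $f^1_x(y)=0$ for $\mu$-almost every $y$ with $f^0_x(y)=0$. Fix $x\in E$ and $d\in\{0,1,2,\dots\}$. On a probability space with probability $P_x$ let $\theta$ and $(X_n)_{n\ge 0}$ be random variables such that $P_x(\theta=j)=p^{j-1}q$ for $j\ge1$, $X_0=x$ almost surely, and, for all $n\ge 0$, given $(\theta,X_0,\dots,X_n)$ the variable $X_{n+1}$ has $\mu$-density $f^0_{X_n}$ on $\{\theta>n+1\}$ and $f^1_{X_n}$ on $\{\theta\le n+1\}$. Thus $X$ follows the first Markov process before the disorder time $\theta$, and from time $\theta$ on the second one, started from $X_{\theta-1}$. Let $\mathcal F_n=\sigma(X_0,\dots,X_n)$. Stopping times are taken with respect to $(\mathcal F_n)$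 and may take the value $\infty$; the event $|\theta-\tau|\le d$ does not occur where $\tau=\infty$. For $x_k,\dots,x_n\in E$ and $0\le m\le n-k$ put $$L_m(x_k,\dots,x_n)=\prod_{r=k+1}^{n-m}f^0_{x_{r-1}}(x_r)\prod_{r=n-m+1}^{n}f^1_{x_{r-1}}(x_r),$$ with empty products equal to $1$, and for $x_1,\dots,x_{d+2}\in E$ put $$\Lambda(x_1,\dots,x_{d+2})=1-p^d+q\sum_{m=1}^{d+1}\frac{L_m(x_1,\dots,x_{d+2})}{p^mL_0(x_1,\dots,x_{d+2})}.$$ Define recursively, with values in $[0,\infty]$ (conventions $a/0=\infty$ for $a>0$, $0/0=0$, $0\cdot\infty=0$), $$r_0(x_1,\dots,x_{d+1})=p\Big[1-p^d+q\sum_{m=1}^{d+1}\frac{L_{m-1}(x_1,\dots,x_{d+1})}{p^mL_0(x_1,\dots,x_{d+1})}\Big],$$ $$r_k(x_1,\dots,x_{d+1})=p\int_E f^0_{x_{d+1}}(y)\max\{\Lambda(x_1,\dots,x_{d+1},y);\,r_{k-1}(x_2,\dots,x_{d+1},y)\}\,\mu(dy),\quad k\ge1.$$ \textbf{Theorem.}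 The limit $r^*=\lim_{k\to\infty}r_k$ exists at every point of $E^{d+1}$, and it is finite at every point where $L_0\ne0$. Moreover: (a) The random time $$\tau^*=\inf\{n\ge d+1:\ \Lambda(X_{n-d-1},\dots,X_n)\ge r^*(X_{n-d},\dots,X_n)\}\qquad(\inf\emptyset=\infty)$$ is a stopping time, and $P_x(|\theta-\tau^*|\le d)=\sup_\tau P_x(|\theta-\tau|\le d)$, where the supremum is over all stopping times $\tau$. (b) The optimal value is $$P_x(|\theta-\tau^*|\le d)=p^{d+1}\int_{E^{d+1}}\max\{\Lambda(x,x_1,\dots,x_{d+1});\,r^*(x_1,\dots,x_{d+1})\}\,L_0(x,x_1,\dots,x_{d+1})\,\mu(dx_1)\cdots\mu(dx_{d+1}).$$ -/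

import Mathlib

open MeasureTheory Filter Topology
open scoped ENNReal NNReal

namespace DisorderDetection

/-- `f x y` is a (jointly measurable) transition density of a homogeneous Markov process with
respect to the reference measure `μ`: for every state `x`, `f x ·` is a probability density. -/
structure IsTransitionDensity {E : Type*} [MeasurableSpace E] (μ : Measure E)
    (f : E → E → ℝ≥0) : Prop where
  measurable : Measurable (Function.uncurry f)
  lintegral_eq_one : ∀ x, ∫⁻ y, (f x y : ℝ≥0∞) ∂μ = 1

/-- Law of the pair `(θ, X)` under `P = P_x`: the time `θ` is geometric on `{1, 2, …}`, the observed
sequence starts at `x`, and, given `θ` and `X 0, …, X n`, the next observation `X (n + 1)` has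
density `f0 (X n) ·` when `n + 1 < θ` and density `f1 (X n) ·` when `θ ≤ n + 1`. Thus `X` follows
the first Markov process before `θ`, and from time `θ` on the second one, started
from the state `X (θ - 1)`. -/
structure IsSwitchedProcess {E Ω : Type*} [MeasurableSpace E] [MeasurableSpace Ω]
    (P : Measure Ω) (μ : Measure E) (p q : ℝ≥0) (f0 f1 : E → E → ℝ≥0) (x : E)
    (θ : Ω → ℕ) (X : ℕ → Ω → E) : Prop where
  measurable_time : Measurable θ
  geometric : ∀ j : ℕ, 1 ≤ j → P {ω | θ ω = j} = ((p ^ (j - 1) * q : ℝ≥0) : ℝ≥0∞)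
  start : ∀ᵐ ω ∂P, X 0 ω = x
  transition : ∀ (n j : ℕ) (B : Set (Fin (n + 1) → E)) (A : Set E),
    MeasurableSet B → MeasurableSet A →
      P {ω | θ ω = j ∧ (fun i : Fin (n + 1) => X i ω) ∈ B ∧ X (n + 1) ω ∈ A} =
        ∫⁻ ω in {ω | θ ω = j ∧ (fun i : Fin (n + 1) => X i ω) ∈ B},
          (∫⁻ y in A, ((if n + 1 < j then f0 (X n ω) y else f1 (X n ω) y : ℝ≥0) : ℝ≥0∞) ∂μ) ∂P

/-- The filtration `F n = σ(X 0, …, X n)` of the observations. -/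
def observed {E Ω : Type*} [MeasurableSpace E] [mΩ : MeasurableSpace Ω] (X : ℕ → Ω → E)
    (hX : ∀ n, Measurable (X n)) : Filtration ℕ mΩ where
  seq n := ⨆ j ≤ n, MeasurableSpace.comap (X j) inferInstance
  mono' := fun _ _ hmn => iSup₂_mono' fun j hj => ⟨j, hj.trans hmn, le_rfl⟩
  le' := fun _ => iSup₂_le fun j _ => (hX j).comap_le

/-- `L_m(x_0, …, x_N)`: the product of the `N` transition densities along `x_0, …, x_N`, where the
last `m` transitions use `f1` and the earlier ones `f0`. -/
noncomputable def L {E : Type*} (f0 f1 : E → E → ℝ≥0) {N : ℕ} (m : ℕ) (x : Fin (N + 1) → E) :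
    ℝ≥0 :=
  ∏ r : Fin N, if (r : ℕ) + m < N then f0 (x r.castSucc) (x r.succ)
    else f1 (x r.castSucc) (x r.succ)

/-- `1 - p^d + q ∑_{m=1}^{d+1} L_m(x) / (p^m L_0(x))` for a window `x` of `d + 2` states. -/
noncomputable def statistic {E : Type*} (p q : ℝ≥0) (f0 f1 : E → E → ℝ≥0) (d : ℕ)
    (x : Fin (d + 2) → E) : ℝ≥0∞ :=
  1 - (p : ℝ≥0∞) ^ d +
    q * ∑ m ∈ Finset.Icc 1 (d + 1), (L f0 f1 m x : ℝ≥0∞) / ((p : ℝ≥0∞) ^ m * L f0 f1 0 x)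

/-- The thresholds `r_k` on windows of `d + 1` states. In the recursion, `Fin.snoc x y` is the window
`x` followed by the new state `y`, and `Fin.tail` deletes the oldest state. -/
noncomputable def threshold {E : Type*} [MeasurableSpace E] (μ : Measure E) (p q : ℝ≥0)
    (f0 f1 : E → E → ℝ≥0) (d : ℕ) : ℕ → (Fin (d + 1) → E) → ℝ≥0∞
  | 0, x => p * (1 - (p : ℝ≥0∞) ^ d +
      q * ∑ m ∈ Finset.Icc 1 (d + 1),
        (L f0 f1 (m - 1) x : ℝ≥0∞) / ((p : ℝ≥0∞) ^ m * L f0 f1 0 x))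
  | k + 1, x => p * ∫⁻ y, (f0 (x (Fin.last d)) y : ℝ≥0∞) *
      max (statistic p q f0 f1 d (Fin.snoc (α := fun _ => E) x y))
        (threshold μ p q f0 f1 d k (Fin.tail (Fin.snoc (α := fun _ => E) x y))) ∂μ

/-- The limit `r* = lim_k r_k`. -/
noncomputable def rStar {E : Type*} [MeasurableSpace E] (μ : Measure E) (p q : ℝ≥0)
    (f0 f1 : E → E → ℝ≥0) (d : ℕ) (x : Fin (d + 1) → E) : ℝ≥0∞ :=
  limUnder atTop (fun k : ℕ => threshold μ p q f0 f1 d k x)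

/-- The rule `τ*`: the first `n ≥ d + 1` at which the statistic of `X_{n-d-1}, …, X_n` is at least
`r*(X_{n-d}, …, X_n)`, and `∞` if there is no such `n`. -/
noncomputable def tauStar {E Ω : Type*} [MeasurableSpace E] (μ : Measure E) (p q : ℝ≥0)
    (f0 f1 : E → E → ℝ≥0) (d : ℕ) (X : ℕ → Ω → E) (ω : Ω) : ℕ∞ :=
  sInf {t : ℕ∞ | ∃ n : ℕ, t = n ∧ d + 1 ≤ n ∧
    rStar μ p q f0 f1 d (fun i => X (n - d + i) ω) ≤
      statistic p q f0 f1 d (fun i => X (n - (d + 1) + i) ω)}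

/-- The event `|θ - τ| ≤ d`; it does not occur where `τ = ∞`. -/
def detection {Ω : Type*} (d : ℕ) (θ : Ω → ℕ) (τ : Ω → ℕ∞) : Set Ω :=
  {ω | ∃ n : ℕ, τ ω = n ∧ |(θ ω : ℤ) - n| ≤ d}

end DisorderDetection

/-!
On the event `n < θ` the observations `X_0, …, X_n` have density `p^n L_0`, and relative to it
`θ = n + 1 - m` has density `q L_m / (p^m L_0)` for `1 ≤ m ≤ n`. Hence stopping at time
`n ≥ d + 1` collects the mean over `{n < θ}` of `Λ(X_{n-d-1}, …, X_n)`: the terms of the sum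
account for `n - d ≤ θ ≤ n`, the constant `1 - p^d` for `n < θ ≤ n + d`.

The thresholds increase from `r_0 = p ∫ f^0 Λ`, so `r*` is a fixed point of the one-step operator,
and the mean of `r*` over `{n < θ}` equals the mean of `max {Λ; r*}` over `{n + 1 < θ}`.
Telescoping this identity from time `d + 1` on bounds the detection probability of every rule that
waits until `d + 1`, with equality for `τ*`: it always takes the larger term, and the remaining mean
at time `n` is at most `P(θ > n - d - 1) → 0`. Waiting until `d + 1` loses nothing, since `θ ≥ 1`.
-/

namespace DisorderDetection

section Ratio

variable {E : Type*} {p q : ℝ≥0} {f0 f1 : E → E → ℝ≥0} {N : ℕ}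

/-- The likelihood ratio `L_m(x) / (p^m L_0(x))`. It is `0` where both likelihoods vanish and `∞`
where only `L_0` does. -/
noncomputable def ratio (p : ℝ≥0) (f0 f1 : E → E → ℝ≥0) (m : ℕ) (x : Fin (N + 1) → E) : ℝ≥0∞ :=
  (L f0 f1 m x : ℝ≥0∞) / ((p : ℝ≥0∞) ^ m * L f0 f1 0 x)

lemma L_succ_snoc (m : ℕ) (w : Fin (N + 1) → E) (y : E) :
    L f0 f1 (m + 1) (Fin.snoc (α := fun _ => E) w y) = L f0 f1 m w * f1 (w (Fin.last N)) y := by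
  unfold L
  rw [Fin.prod_univ_castSucc]
  congr 1
  · refine Finset.prod_congr rfl fun i _ => ?_
    simp only [Fin.val_castSucc, ← add_assoc, add_lt_add_iff_right, Fin.succ_castSucc,
      Fin.snoc_castSucc]
  · simp

lemma L_zero_snoc (w : Fin (N + 1) → E) (y : E) :
    L f0 f1 0 (Fin.snoc (α := fun _ => E) w y) = L f0 f1 0 w * f0 (w (Fin.last N)) y := by
  unfold L
  rw [Fin.prod_univ_castSucc]
  congr 1
  · refine Finset.prod_congr rfl fun i _ => ?_
    simp [-Fin.castSucc_succ, Fin.succ_castSucc, i.is_lt.trans (Nat.lt_succ_self N)]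
  · simp

lemma L_eq_mul_tail {m : ℕ} (hm : m ≤ N) (w : Fin (N + 2) → E) :
    L f0 f1 m w = f0 (w 0) (w 1) * L f0 f1 m (Fin.tail w) := by
  unfold L
  rw [Fin.prod_univ_succ]
  congr 1
  · simp [Nat.lt_succ_of_le hm]
  · refine Finset.prod_congr rfl fun i _ => ?_
    simp only [Fin.val_succ, add_right_comm, add_lt_add_iff_right, Fin.tail, Fin.succ_castSucc]

lemma L_tail_ne_zero {w : Fin (N + 2) → E} (hw : L f0 f1 0 w ≠ 0) : L f0 f1 0 (Fin.tail w) ≠ 0 := by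
  rw [L_eq_mul_tail (Nat.zero_le N)] at hw
  exact right_ne_zero_of_mul hw

lemma ratio_tail {m : ℕ} (hm : m ≤ N) {w : Fin (N + 2) → E} (hw : L f0 f1 0 w ≠ 0) :
    ratio p f0 f1 m (Fin.tail w) = ratio p f0 f1 m w := by
  have hf : f0 (w 0) (w 1) ≠ 0 := by
    rw [L_eq_mul_tail (Nat.zero_le N)] at hw
    exact left_ne_zero_of_mul hw
  unfold ratio
  rw [L_eq_mul_tail hm w, L_eq_mul_tail (Nat.zero_le N) w, ENNReal.coe_mul, ENNReal.coe_mul,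
    mul_left_comm]
  exact (ENNReal.mul_div_mul_left _ _ (by simpa using hf) ENNReal.coe_ne_top).symm

lemma ratio_zero {w : Fin (N + 1) → E} (hw : L f0 f1 0 w ≠ 0) : ratio p f0 f1 0 w = 1 := by
  rw [ratio, pow_zero, one_mul]
  exact ENNReal.div_self (by simpa using hw) ENNReal.coe_ne_top

lemma ratio_ne_top (hp : p ≠ 0) (m : ℕ) {w : Fin (N + 1) → E} (hw : L f0 f1 0 w ≠ 0) :
    ratio p f0 f1 m w ≠ ∞ :=
  ENNReal.div_ne_top ENNReal.coe_ne_top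
    (mul_ne_zero (pow_ne_zero _ (by simpa using hp)) (by simpa using hw))

lemma mul_ratio_succ_snoc (hp : p ≠ 0) (m : ℕ) (w : Fin (N + 1) → E) {y : E}
    (hy : f0 (w (Fin.last N)) y = 0 → f1 (w (Fin.last N)) y = 0) :
    p * (f0 (w (Fin.last N)) y * ratio p f0 f1 (m + 1) (Fin.snoc (α := fun _ => E) w y)) =
      ratio p f0 f1 m w * f1 (w (Fin.last N)) y := by
  by_cases h : f0 (w (Fin.last N)) y = 0
  · simp [h, hy h]
  have hpf : (p * f0 (w (Fin.last N)) y : ℝ≥0∞) ≠ 0 := by simp [hp, h]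
  have hpf' : (p * f0 (w (Fin.last N)) y : ℝ≥0∞) ≠ ∞ := by finiteness
  calc p * (f0 (w (Fin.last N)) y * ratio p f0 f1 (m + 1) (Fin.snoc (α := fun _ => E) w y))
    _ = p * f0 (w (Fin.last N)) y * (L f0 f1 m w * f1 (w (Fin.last N)) y) /
          (p * f0 (w (Fin.last N)) y * (p ^ m * L f0 f1 0 w)) := by
      rw [ratio, L_succ_snoc, L_zero_snoc, ENNReal.coe_mul, ENNReal.coe_mul, ← mul_assoc,
        ← mul_div_assoc]
      ring_nf
    _ = ratio p f0 f1 m w * f1 (w (Fin.last N)) y := by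
      rw [ENNReal.mul_div_mul_left _ _ hpf hpf', ENNReal.mul_div_right_comm, ratio]

lemma statistic_eq_sum_range (d : ℕ) (w : Fin (d + 2) → E) :
    statistic p q f0 f1 d w =
      1 - (p : ℝ≥0∞) ^ d + q * ∑ m ∈ Finset.range (d + 1), ratio p f0 f1 (m + 1) w := by
  rw [Finset.range_eq_Ico, Finset.sum_Ico_add' (fun m => ratio p f0 f1 m w)]
  rfl

lemma add_mul_sum_range_ratio (hpq : p + q = 1) (k : ℕ) {w : Fin (N + 1) → E}
    (hw : L f0 f1 0 w ≠ 0) :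
    p + q * ∑ m ∈ Finset.range (k + 1), ratio p f0 f1 m w =
      1 + q * ∑ m ∈ Finset.range k, ratio p f0 f1 (m + 1) w := by
  have hpq' : (p : ℝ≥0∞) + q = 1 := by exact_mod_cast hpq
  rw [Finset.sum_range_succ', ratio_zero hw, mul_add, mul_one, add_left_comm, hpq', add_comm]

end Ratio

section Measurability

variable {E : Type*} [MeasurableSpace E] {p q : ℝ≥0} {f0 f1 : E → E → ℝ≥0} {N : ℕ}

lemma measurable_snoc : Measurable fun t : (Fin N → E) × E =>
    (Fin.snoc (α := fun _ => E) t.1 t.2 : Fin (N + 1) → E) := by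
  refine measurable_pi_lambda _ (Fin.lastCases ?_ fun i => ?_)
  · simpa using measurable_snd
  · simpa [Function.comp_def] using (measurable_pi_apply i).comp measurable_fst

lemma measurable_tail : Measurable (Fin.tail : (Fin (N + 1) → E) → Fin N → E) :=
  measurable_pi_lambda _ fun i => measurable_pi_apply i.succ

lemma measurable_cons {n : ℕ} (x : E) :
    Measurable fun y : Fin n → E => (Fin.cons (α := fun _ => E) x y : Fin (n + 1) → E) :=
  measurable_pi_lambda _ (Fin.cases (by simp) fun i => by simpa using measurable_pi_apply i)

lemma lintegral_pi_snoc {μ : Measure E} [SigmaFinite μ] (n : ℕ) {φ : (Fin (n + 1) → E) → ℝ≥0∞}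
    (hφ : Measurable φ) :
    ∫⁻ v, φ v ∂(Measure.pi fun _ : Fin (n + 1) => μ) =
      ∫⁻ w, ∫⁻ y, φ (Fin.snoc (α := fun _ => E) w y) ∂μ ∂(Measure.pi fun _ : Fin n => μ) := by
  have h := (measurePreserving_piFinSuccAbove (fun _ : Fin (n + 1) => μ) (Fin.last n)).symm
  rw [← h.lintegral_comp hφ]
  refine (lintegral_prod_symm _ (hφ.comp (MeasurableEquiv.measurable _)).aemeasurable).trans ?_
  simp [MeasurableEquiv.piFinSuccAbove, Fin.snocEquiv]

lemma measurable_comp_density {α : Type*} [MeasurableSpace α] {f : E → E → ℝ≥0}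
    (hf : Measurable (Function.uncurry f)) {a b : α → E} (ha : Measurable a) (hb : Measurable b) :
    Measurable fun t => f (a t) (b t) :=
  hf.comp (ha.prodMk hb)

lemma measurable_L (hf0 : Measurable (Function.uncurry f0)) (hf1 : Measurable (Function.uncurry f1))
    (m : ℕ) : Measurable (L f0 f1 (N := N) m) := by
  unfold L
  refine Finset.measurable_prod _ fun r _ => ?_
  split_ifs
  · exact measurable_comp_density hf0 (measurable_pi_apply _) (measurable_pi_apply _)
  · exact measurable_comp_density hf1 (measurable_pi_apply _) (measurable_pi_apply _)

lemma measurable_ratio (hf0 : Measurable (Function.uncurry f0))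
    (hf1 : Measurable (Function.uncurry f1)) (m : ℕ) :
    Measurable (ratio p f0 f1 (N := N) m) :=
  (measurable_L hf0 hf1 m).coe_nnreal_ennreal.div
    ((measurable_L hf0 hf1 0).coe_nnreal_ennreal.const_mul _)

lemma measurable_statistic (hf0 : Measurable (Function.uncurry f0))
    (hf1 : Measurable (Function.uncurry f1)) (d : ℕ) : Measurable (statistic p q f0 f1 d) :=
  ((Finset.measurable_sum _ fun m _ => measurable_ratio hf0 hf1 m).const_mul _).const_add _

end Measurability

section StepMean

variable {E : Type*} [MeasurableSpace E] {μ : Measure E} {p q : ℝ≥0} {f f0 f1 : E → E → ℝ≥0}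
  {N : ℕ}

/-- The mean of `φ` over the path `w` prolonged by one transition of density `f`. -/
noncomputable def stepMean (μ : Measure E) (f : E → E → ℝ≥0) (φ : (Fin (N + 2) → E) → ℝ≥0∞)
    (w : Fin (N + 1) → E) : ℝ≥0∞ :=
  ∫⁻ y, f (w (Fin.last N)) y * φ (Fin.snoc (α := fun _ => E) w y) ∂μ

lemma measurable_density_last (hf : Measurable (Function.uncurry f)) :
    Measurable fun t : (Fin (N + 1) → E) × E => (f (t.1 (Fin.last N)) t.2 : ℝ≥0∞) :=
  (measurable_comp_density hf ((measurable_pi_apply _).comp measurable_fst)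
    measurable_snd).coe_nnreal_ennreal

lemma measurable_density_mul_snoc (hf : Measurable (Function.uncurry f))
    {φ : (Fin (N + 2) → E) → ℝ≥0∞} (hφ : Measurable φ) :
    Measurable fun t : (Fin (N + 1) → E) × E =>
      (f (t.1 (Fin.last N)) t.2 : ℝ≥0∞) * φ (Fin.snoc (α := fun _ => E) t.1 t.2) :=
  (measurable_density_last hf).mul (hφ.comp measurable_snoc)

lemma measurable_density_mul_snoc_left (hf : Measurable (Function.uncurry f))
    {φ : (Fin (N + 2) → E) → ℝ≥0∞} (hφ : Measurable φ) (w : Fin (N + 1) → E) :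
    Measurable fun y => (f (w (Fin.last N)) y : ℝ≥0∞) * φ (Fin.snoc (α := fun _ => E) w y) :=
  (measurable_density_mul_snoc hf hφ).comp measurable_prodMk_left

lemma measurable_stepMean [SFinite μ] (hf : Measurable (Function.uncurry f))
    {φ : (Fin (N + 2) → E) → ℝ≥0∞} (hφ : Measurable φ) : Measurable (stepMean μ f φ) :=
  (measurable_density_mul_snoc hf hφ).lintegral_prod_right'

lemma stepMean_mono {φ ψ : (Fin (N + 2) → E) → ℝ≥0∞} {w : Fin (N + 1) → E}
    (h : ∀ y, f (w (Fin.last N)) y ≠ 0 →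
      φ (Fin.snoc (α := fun _ => E) w y) ≤ ψ (Fin.snoc (α := fun _ => E) w y)) :
    stepMean μ f φ w ≤ stepMean μ f ψ w := by
  refine lintegral_mono fun y => ?_
  by_cases hy : f (w (Fin.last N)) y = 0
  · simp [hy]
  · exact mul_le_mul_right (h y hy) _

lemma stepMean_const (hf : IsTransitionDensity μ f) (c : ℝ≥0∞) (w : Fin (N + 1) → E) :
    stepMean μ f (fun _ => c) w = c := by
  rw [stepMean, lintegral_mul_const _ hf.measurable.of_uncurry_left.coe_nnreal_ennreal,
    hf.lintegral_eq_one, one_mul]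

lemma mul_stepMean_ratio_succ_mul (hf1 : Measurable (Function.uncurry f1))
    (hac : ∀ y, ∀ᵐ z ∂μ, f0 y z = 0 → f1 y z = 0) (hp : p ≠ 0) (m : ℕ)
    {φ : (Fin (N + 2) → E) → ℝ≥0∞} (hφ : Measurable φ) (w : Fin (N + 1) → E) :
    p * stepMean μ f0 (fun v => ratio p f0 f1 (m + 1) v * φ v) w =
      ratio p f0 f1 m w * stepMean μ f1 φ w := by
  rw [stepMean, stepMean, ← lintegral_const_mul' _ _ ENNReal.coe_ne_top,
    ← lintegral_const_mul _ (measurable_density_mul_snoc_left hf1 hφ w)]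
  refine lintegral_congr_ae ?_
  filter_upwards [hac (w (Fin.last N))] with y hy
  rw [← mul_assoc (ratio p f0 f1 m w), ← mul_ratio_succ_snoc hp m w hy]
  ring

lemma mul_stepMean_ratio_succ (hf1 : IsTransitionDensity μ f1)
    (hac : ∀ y, ∀ᵐ z ∂μ, f0 y z = 0 → f1 y z = 0) (hp : p ≠ 0) (m : ℕ) (w : Fin (N + 1) → E) :
    p * stepMean μ f0 (ratio p f0 f1 (m + 1)) w = ratio p f0 f1 m w := by
  simpa [stepMean_const hf1] using
    mul_stepMean_ratio_succ_mul (φ := fun _ => 1) hf1.measurable hac hp m measurable_const w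

lemma mul_stepMean_add_mul_sum_ratio_succ (hf0 : IsTransitionDensity μ f0)
    (hf1 : IsTransitionDensity μ f1) (hac : ∀ y, ∀ᵐ z ∂μ, f0 y z = 0 → f1 y z = 0)
    (hp : p ≠ 0) (k : ℕ) (c : ℝ≥0∞) (w : Fin (N + 1) → E) :
    p * stepMean μ f0 (fun v => c + q * ∑ m ∈ Finset.range k, ratio p f0 f1 (m + 1) v) w =
      p * c + q * ∑ m ∈ Finset.range k, ratio p f0 f1 m w := by
  have hlin : stepMean μ f0
        (fun v => c + q * ∑ m ∈ Finset.range k, ratio p f0 f1 (m + 1) v) w =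
      c + q * ∑ m ∈ Finset.range k, stepMean μ f0 (ratio p f0 f1 (m + 1)) w := by
    conv_rhs => rw [← stepMean_const hf0 c w]
    simp only [stepMean, mul_add, mul_left_comm _ (q : ℝ≥0∞)]
    rw [lintegral_add_left
      (measurable_density_mul_snoc_left (φ := fun _ => c) hf0.measurable measurable_const w),
      lintegral_const_mul' _ _ ENNReal.coe_ne_top]
    simp only [Finset.mul_sum]
    rw [lintegral_finsetSum _ fun m _ => measurable_density_mul_snoc_left hf0.measurable
      (measurable_ratio hf0.measurable hf1.measurable (m + 1)) w, Finset.mul_sum]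
  rw [hlin, mul_add, mul_left_comm, Finset.mul_sum (a := (p : ℝ≥0∞))]
  simp only [mul_stepMean_ratio_succ hf1 hac hp]

end StepMean

section Threshold

variable {E : Type*} [MeasurableSpace E] {μ : Measure E} {p q : ℝ≥0} {f0 f1 : E → E → ℝ≥0}

lemma threshold_succ (d k : ℕ) (w : Fin (d + 1) → E) :
    threshold μ p q f0 f1 d (k + 1) w =
      p * stepMean μ f0 (fun v => max (statistic p q f0 f1 d v)
        (threshold μ p q f0 f1 d k (Fin.tail v))) w :=
  rfl

lemma threshold_zero (hp : p ≠ 0) (d : ℕ) (w : Fin (d + 1) → E) :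
    threshold μ p q f0 f1 d 0 w =
      p * (1 - (p : ℝ≥0∞) ^ d) + q * ∑ m ∈ Finset.range (d + 1), ratio p f0 f1 m w := by
  have hp' : (p : ℝ≥0∞) ≠ 0 := by simpa using hp
  have hterm (m : ℕ) : (p : ℝ≥0∞) *
      ((L f0 f1 (m + 1 - 1) w : ℝ≥0∞) / ((p : ℝ≥0∞) ^ (m + 1) * L f0 f1 0 w)) =
        ratio p f0 f1 m w := by
    rw [Nat.add_sub_cancel, ratio, pow_succ', mul_assoc, ← mul_div_assoc,
      ENNReal.mul_div_mul_left _ _ hp' ENNReal.coe_ne_top]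
  rw [threshold, mul_add, mul_left_comm, Finset.mul_sum (Finset.Icc 1 (d + 1)),
    ← Finset.sum_congr rfl fun m _ => hterm m, Finset.range_eq_Ico,
    Finset.sum_Ico_add' fun m => (p : ℝ≥0∞) *
      ((L f0 f1 (m - 1) w : ℝ≥0∞) / ((p : ℝ≥0∞) ^ m * L f0 f1 0 w))]
  rfl

lemma measurable_threshold [SFinite μ] (hf0 : Measurable (Function.uncurry f0))
    (hf1 : Measurable (Function.uncurry f1)) (hp : p ≠ 0) (d k : ℕ) :
    Measurable (threshold μ p q f0 f1 d k) := by
  induction k with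
  | zero =>
    rw [funext (threshold_zero hp d)]
    exact ((Finset.measurable_sum _ fun m _ => measurable_ratio hf0 hf1 m).const_mul _).const_add _
  | succ k ih =>
    exact (measurable_stepMean hf0 ((measurable_statistic hf0 hf1 d).max
      (ih.comp measurable_tail))).const_mul _

section Density

variable (hf0 : IsTransitionDensity μ f0) (hf1 : IsTransitionDensity μ f1)
  (hac : ∀ y, ∀ᵐ z ∂μ, f0 y z = 0 → f1 y z = 0) (hp : p ≠ 0)

include hf0 hf1 hac hp

lemma threshold_zero_eq_mul_stepMean (d : ℕ) (w : Fin (d + 1) → E) :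
    threshold μ p q f0 f1 d 0 w = p * stepMean μ f0 (statistic p q f0 f1 d) w := by
  rw [funext (statistic_eq_sum_range d), mul_stepMean_add_mul_sum_ratio_succ hf0 hf1 hac hp,
    threshold_zero hp]

lemma threshold_mono (d : ℕ) : Monotone (threshold μ p q f0 f1 d) := by
  refine monotone_nat_of_le_succ fun k => ?_
  induction k with
  | zero =>
    intro w
    rw [threshold_zero_eq_mul_stepMean hf0 hf1 hac hp, threshold_succ]
    exact mul_le_mul_right (stepMean_mono fun y _ => le_max_left _ _) _
  | succ k ih =>
    intro w
    rw [threshold_succ, threshold_succ]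
    exact mul_le_mul_right (stepMean_mono fun y _ => max_le_max_left _ (ih _)) _

lemma tendsto_threshold_iSup (d : ℕ) (w : Fin (d + 1) → E) :
    Tendsto (fun k => threshold μ p q f0 f1 d k w) atTop (𝓝 (⨆ k, threshold μ p q f0 f1 d k w)) :=
  tendsto_atTop_iSup fun _ _ h => threshold_mono hf0 hf1 hac hp d h w

lemma rStar_eq_iSup (d : ℕ) (w : Fin (d + 1) → E) :
    rStar μ p q f0 f1 d w = ⨆ k, threshold μ p q f0 f1 d k w :=
  (tendsto_threshold_iSup hf0 hf1 hac hp d w).limUnder_eq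

lemma tendsto_threshold_rStar (d : ℕ) (w : Fin (d + 1) → E) :
    Tendsto (fun k => threshold μ p q f0 f1 d k w) atTop (𝓝 (rStar μ p q f0 f1 d w)) := by
  rw [rStar_eq_iSup hf0 hf1 hac hp]
  exact tendsto_threshold_iSup hf0 hf1 hac hp d w

lemma measurable_rStar [SFinite μ] (d : ℕ) : Measurable (rStar μ p q f0 f1 d) := by
  rw [funext (rStar_eq_iSup hf0 hf1 hac hp d)]
  exact Measurable.iSup fun k => measurable_threshold hf0.measurable hf1.measurable hp d k

/-- The bound is `p` times the conditional mean of the odds that the disorder is still within reach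
of a stop at the next step, and those odds reproduce themselves under the recursion. -/
lemma threshold_le (hpq : p + q = 1) (d k : ℕ) {w : Fin (d + 1) → E} (hw : L f0 f1 0 w ≠ 0) :
    threshold μ p q f0 f1 d k w ≤ p + q * ∑ m ∈ Finset.range (d + 1), ratio p f0 f1 m w := by
  have hmean (w : Fin (d + 1) → E) : p * stepMean μ f0
      (fun v => 1 + q * ∑ m ∈ Finset.range (d + 1), ratio p f0 f1 (m + 1) v) w =
        p + q * ∑ m ∈ Finset.range (d + 1), ratio p f0 f1 m w := by
    rw [mul_stepMean_add_mul_sum_ratio_succ hf0 hf1 hac hp, mul_one]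
  have hstat (v : Fin (d + 2) → E) : statistic p q f0 f1 d v ≤
      1 + q * ∑ m ∈ Finset.range (d + 1), ratio p f0 f1 (m + 1) v := by
    rw [statistic_eq_sum_range]
    gcongr
    exact tsub_le_self
  induction k generalizing w with
  | zero =>
    rw [threshold_zero_eq_mul_stepMean hf0 hf1 hac hp, ← hmean]
    exact mul_le_mul_right (stepMean_mono fun y _ => hstat _) _
  | succ k ih =>
    rw [threshold_succ, ← hmean]
    refine mul_le_mul_right (stepMean_mono fun y hy => max_le (hstat _) ?_) _
    have hwy : L f0 f1 0 (Fin.snoc (α := fun _ => E) w y) ≠ 0 := by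
      rw [L_zero_snoc]
      exact mul_ne_zero hw hy
    refine (ih (L_tail_ne_zero hwy)).trans ?_
    rw [Finset.sum_congr rfl fun m hm => ratio_tail (Finset.mem_range_succ_iff.1 hm) hwy,
      add_mul_sum_range_ratio hpq d hwy, Finset.sum_range_succ _ d]
    gcongr
    exact le_self_add

lemma rStar_le (hpq : p + q = 1) (d : ℕ) {w : Fin (d + 1) → E} (hw : L f0 f1 0 w ≠ 0) :
    rStar μ p q f0 f1 d w ≤ p + q * ∑ m ∈ Finset.range (d + 1), ratio p f0 f1 m w := by
  rw [rStar_eq_iSup hf0 hf1 hac hp]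
  exact iSup_le fun k => threshold_le hf0 hf1 hac hp hpq d k hw

lemma rStar_lt_top (hpq : p + q = 1) (d : ℕ) {w : Fin (d + 1) → E} (hw : L f0 f1 0 w ≠ 0) :
    rStar μ p q f0 f1 d w < ∞ :=
  (rStar_le hf0 hf1 hac hp hpq d hw).trans_lt <| ENNReal.add_lt_top.2 ⟨ENNReal.coe_lt_top,
    ENNReal.mul_lt_top ENNReal.coe_lt_top
      (ENNReal.sum_lt_top.2 fun m _ => (ratio_ne_top hp m hw).lt_top)⟩

end Density

/-- The payoff `max {Λ; r*}` of the optimal choice between stopping at the end of the window `v` and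
continuing. -/
noncomputable def optimalPayoff (μ : Measure E) (p q : ℝ≥0) (f0 f1 : E → E → ℝ≥0) (d : ℕ)
    (v : Fin (d + 2) → E) : ℝ≥0∞ :=
  max (statistic p q f0 f1 d v) (rStar μ p q f0 f1 d (Fin.tail v))

section Payoff

variable [SFinite μ] (hf0 : IsTransitionDensity μ f0) (hf1 : IsTransitionDensity μ f1)
  (hac : ∀ y, ∀ᵐ z ∂μ, f0 y z = 0 → f1 y z = 0) (hp : p ≠ 0)

include hf0 hf1 hac hp

lemma measurable_optimalPayoff (d : ℕ) : Measurable (optimalPayoff μ p q f0 f1 d) :=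
  (measurable_statistic hf0.measurable hf1.measurable d).max
    ((measurable_rStar hf0 hf1 hac hp d).comp measurable_tail)

lemma rStar_eq_mul_stepMean (d : ℕ) (w : Fin (d + 1) → E) :
    rStar μ p q f0 f1 d w = p * stepMean μ f0 (optimalPayoff μ p q f0 f1 d) w := by
  refine tendsto_nhds_unique ((tendsto_threshold_rStar hf0 hf1 hac hp d w).comp
    (tendsto_add_atTop_nat 1)) (ENNReal.Tendsto.const_mul ?_ (Or.inr ENNReal.coe_ne_top))
  refine lintegral_tendsto_of_tendsto_of_monotone
    (fun k => (measurable_density_mul_snoc_left hf0.measurable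
      ((measurable_statistic hf0.measurable hf1.measurable d).max ((measurable_threshold
        hf0.measurable hf1.measurable hp d k).comp measurable_tail)) w).aemeasurable)
    (ae_of_all _ fun y k l hkl => ?_) (ae_of_all _ fun y => ?_)
  · exact mul_le_mul_right (max_le_max_left _ (threshold_mono hf0 hf1 hac hp d hkl _)) _
  · exact ENNReal.Tendsto.const_mul
      (tendsto_const_nhds.max (tendsto_threshold_rStar hf0 hf1 hac hp d _))
      (Or.inr ENNReal.coe_ne_top)

end Payoff

end Threshold

section Extend

variable {E : Type*} [MeasurableSpace E] {μ : Measure E} {p : ℝ≥0} {f f0 f1 : E → E → ℝ≥0}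
  {N : ℕ}

/-- The law of a path of law `ν` prolonged by one transition of density `f`. -/
noncomputable def extend (μ : Measure E) (f : E → E → ℝ≥0) (ν : Measure (Fin (N + 1) → E)) :
    Measure (Fin (N + 2) → E) :=
  ((ν.prod μ).withDensity fun t => (f (t.1 (Fin.last N)) t.2 : ℝ≥0∞)).map
    fun t => Fin.snoc (α := fun _ => E) t.1 t.2

variable [SFinite μ]

lemma lintegral_extend (hf : Measurable (Function.uncurry f)) (ν : Measure (Fin (N + 1) → E))
    {φ : (Fin (N + 2) → E) → ℝ≥0∞} (hφ : Measurable φ) :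
    ∫⁻ v, φ v ∂(extend μ f ν) = ∫⁻ w, stepMean μ f φ w ∂ν := by
  rw [extend, lintegral_map hφ measurable_snoc]
  refine (lintegral_withDensity_eq_lintegral_mul _ (measurable_density_last hf)
    (hφ.comp measurable_snoc)).trans ?_
  exact lintegral_prod _ (measurable_density_mul_snoc hf hφ).aemeasurable

lemma extend_smul (hf : Measurable (Function.uncurry f)) (c : ℝ≥0∞)
    (ν : Measure (Fin (N + 1) → E)) : extend μ f (c • ν) = c • extend μ f ν := by
  refine Measure.ext_of_lintegral _ fun φ hφ => ?_
  rw [lintegral_smul_measure, lintegral_extend hf _ hφ, lintegral_extend hf _ hφ,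
    lintegral_smul_measure]

lemma extend_sum {ι : Type*} (hf : Measurable (Function.uncurry f))
    (ν : ι → Measure (Fin (N + 1) → E)) :
    extend μ f (Measure.sum ν) = Measure.sum fun i => extend μ f (ν i) := by
  refine Measure.ext_of_lintegral _ fun φ hφ => ?_
  rw [lintegral_extend hf _ hφ, lintegral_sum_measure, lintegral_sum_measure]
  exact tsum_congr fun i => (lintegral_extend hf _ hφ).symm

lemma extend_withDensity_ratio (hf0 : Measurable (Function.uncurry f0))
    (hf1 : Measurable (Function.uncurry f1)) (hac : ∀ y, ∀ᵐ z ∂μ, f0 y z = 0 → f1 y z = 0)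
    (hp : p ≠ 0) (m : ℕ) (ν : Measure (Fin (N + 1) → E)) :
    extend μ f1 (ν.withDensity (ratio p f0 f1 m)) =
      (p : ℝ≥0∞) • (extend μ f0 ν).withDensity (ratio p f0 f1 (m + 1)) := by
  refine Measure.ext_of_lintegral _ fun φ hφ => ?_
  have hr (m N : ℕ) : Measurable (ratio p f0 f1 (N := N) m) := measurable_ratio hf0 hf1 m
  calc ∫⁻ v, φ v ∂(extend μ f1 (ν.withDensity (ratio p f0 f1 m)))
    _ = ∫⁻ w, ratio p f0 f1 m w * stepMean μ f1 φ w ∂ν := by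
      rw [lintegral_extend hf1 _ hφ, lintegral_withDensity_eq_lintegral_mul _ (hr m N)
        (measurable_stepMean hf1 hφ)]
      rfl
    _ = p * ∫⁻ w, stepMean μ f0 (fun v => ratio p f0 f1 (m + 1) v * φ v) w ∂ν := by
      rw [← lintegral_const_mul' _ _ ENNReal.coe_ne_top]
      exact lintegral_congr fun w => (mul_stepMean_ratio_succ_mul hf1 hac hp m hφ w).symm
    _ = ∫⁻ v, φ v ∂((p : ℝ≥0∞) • (extend μ f0 ν).withDensity (ratio p f0 f1 (m + 1))) := by
      rw [lintegral_smul_measure, lintegral_withDensity_eq_lintegral_mul _ (hr _ _) hφ]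
      exact congrArg _ (lintegral_extend hf0 ν ((hr _ _).mul hφ)).symm

end Extend

section HistoryLaw

variable {E Ω : Type*} [MeasurableSpace Ω] {P : Measure Ω} {θ : Ω → ℕ} {X : ℕ → Ω → E}

/-- The observed path `X_0, …, X_n`. -/
def history (X : ℕ → Ω → E) (n : ℕ) (ω : Ω) : Fin (n + 1) → E := fun i => X i ω

omit [MeasurableSpace Ω] in
lemma history_succ (n : ℕ) (ω : Ω) :
    history X (n + 1) ω = Fin.snoc (α := fun _ => E) (history X n ω) (X (n + 1) ω) := by
  refine funext (Fin.lastCases ?_ fun i => ?_) <;> simp [history]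

variable [MeasurableSpace E]

lemma measurable_history (hX : ∀ n, Measurable (X n)) (n : ℕ) : Measurable (history X n) :=
  measurable_pi_lambda _ fun i => hX i

/-- The law of `X_0, …, X_n` on the event `θ ∈ s`; it is not normalized, its mass being `P(θ ∈ s)`.
-/
noncomputable def historyLaw (P : Measure Ω) (θ : Ω → ℕ) (X : ℕ → Ω → E) (n : ℕ) (s : Set ℕ) :
    Measure (Fin (n + 1) → E) :=
  (P.restrict (θ ⁻¹' s)).map (history X n)

instance isFiniteMeasure_historyLaw [IsFiniteMeasure P] (n : ℕ) (s : Set ℕ) :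
    IsFiniteMeasure (historyLaw P θ X n s) := by
  unfold historyLaw
  infer_instance

lemma lintegral_historyLaw (hX : ∀ n, Measurable (X n)) (n : ℕ) (s : Set ℕ)
    {φ : (Fin (n + 1) → E) → ℝ≥0∞} (hφ : Measurable φ) :
    ∫⁻ w, φ w ∂(historyLaw P θ X n s) = ∫⁻ ω in θ ⁻¹' s, φ (history X n ω) ∂P :=
  lintegral_map hφ (measurable_history hX n)

lemma historyLaw_apply (hX : ∀ n, Measurable (X n)) (n : ℕ) (s : Set ℕ)
    {B : Set (Fin (n + 1) → E)} (hB : MeasurableSet B) :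
    historyLaw P θ X n s B = P (history X n ⁻¹' B ∩ θ ⁻¹' s) := by
  rw [historyLaw, Measure.map_apply (measurable_history hX n) hB,
    Measure.restrict_apply (measurable_history hX n hB)]

lemma setLIntegral_historyLaw (hX : ∀ n, Measurable (X n)) (n : ℕ) (s : Set ℕ)
    {B : Set (Fin (n + 1) → E)} (hB : MeasurableSet B) {φ : (Fin (n + 1) → E) → ℝ≥0∞}
    (hφ : Measurable φ) :
    ∫⁻ w in B, φ w ∂(historyLaw P θ X n s) =
      ∫⁻ ω in history X n ⁻¹' B ∩ θ ⁻¹' s, φ (history X n ω) ∂P := by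
  rw [historyLaw, setLIntegral_map hB hφ (measurable_history hX n),
    Measure.restrict_restrict (measurable_history hX n hB)]

lemma historyLaw_union (hθ : Measurable θ) (hX : ∀ n, Measurable (X n)) (n : ℕ) {s t : Set ℕ}
    (hst : Disjoint s t) :
    historyLaw P θ X n (s ∪ t) = historyLaw P θ X n s + historyLaw P θ X n t := by
  rw [historyLaw, Set.preimage_union,
    Measure.restrict_union (hst.preimage θ) (hθ MeasurableSet.of_discrete),
    Measure.map_add _ _ (measurable_history hX n)]
  rfl

lemma historyLaw_Ioi_eq_sum (hθ : Measurable θ) (hX : ∀ n, Measurable (X n)) (n m : ℕ) :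
    historyLaw P θ X n (Set.Ioi m) = Measure.sum fun k => historyLaw P θ X n {m + 1 + k} := by
  have hIoi : θ ⁻¹' Set.Ioi m = ⋃ k, θ ⁻¹' {m + 1 + k} := by
    ext ω
    simp only [Set.mem_preimage, Set.mem_Ioi, Set.mem_iUnion, Set.mem_singleton_iff]
    exact ⟨fun h => ⟨θ ω - (m + 1), by omega⟩, fun ⟨k, hk⟩ => by omega⟩
  have hdisj : Pairwise (Function.onFun Disjoint fun k => θ ⁻¹' {m + 1 + k}) := fun i j hij =>
    Disjoint.preimage θ (Set.disjoint_singleton.2 fun h => hij (Nat.add_left_cancel h))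
  rw [historyLaw, hIoi, Measure.restrict_iUnion hdisj fun k => hθ MeasurableSet.of_discrete,
    Measure.map_sum (measurable_history hX n).aemeasurable]
  rfl

end HistoryLaw

section SwitchedProcess

variable {E Ω : Type*} [MeasurableSpace E] [MeasurableSpace Ω] {P : Measure Ω}
  {μ : Measure E} {p q : ℝ≥0} {f0 f1 : E → E → ℝ≥0} {x : E} {θ : Ω → ℕ} {X : ℕ → Ω → E}

lemma historyLaw_zero (hmodel : IsSwitchedProcess P μ p q f0 f1 x θ X) (s : Set ℕ) :
    historyLaw P θ X 0 s = P (θ ⁻¹' s) • Measure.dirac fun _ => x := by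
  have hstart : history X 0 =ᵐ[P.restrict (θ ⁻¹' s)] fun _ _ => x := by
    filter_upwards [ae_restrict_of_ae hmodel.start] with ω hω
    refine funext fun i => ?_
    rw [history, Fin.val_eq_zero i, hω]
  rw [historyLaw, Measure.map_congr hstart, Measure.map_const, Measure.restrict_apply_univ]

section Transition

variable [IsFiniteMeasure P] [SFinite μ] (hf0 : Measurable (Function.uncurry f0))
  (hf1 : Measurable (Function.uncurry f1)) (hX : ∀ n, Measurable (X n))
  (hmodel : IsSwitchedProcess P μ p q f0 f1 x θ X)

include hf0 hf1 hX hmodel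

lemma historyLaw_succ_singleton (n j : ℕ) :
    historyLaw P θ X (n + 1) {j} =
      extend μ (if n + 1 < j then f0 else f1) (historyLaw P θ X n {j}) := by
  have hf : Measurable (Function.uncurry (if n + 1 < j then f0 else f1)) := by
    split_ifs <;> assumption
  have hH := measurable_history hX n
  have hpair : Measurable fun ω => (history X n ω, X (n + 1) ω) := hH.prodMk (hX (n + 1))
  have hlaw : (P.restrict (θ ⁻¹' {j})).map (fun ω => (history X n ω, X (n + 1) ω)) =
      ((historyLaw P θ X n {j}).prod μ).withDensity fun t =>
        ((if n + 1 < j then f0 else f1) (t.1 (Fin.last n)) t.2 : ℝ≥0∞) := by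
    refine Measure.ext_prod fun {B A} hB hA => ?_
    have hdens := measurable_density_last (N := n) hf
    rw [Measure.map_apply hpair (hB.prod hA), Measure.restrict_apply (hpair (hB.prod hA)),
      withDensity_apply _ (hB.prod hA), setLIntegral_prod _ hdens.aemeasurable, historyLaw,
      setLIntegral_map hB hdens.lintegral_prod_right' hH,
      Measure.restrict_restrict (hH hB), Set.inter_comm, Set.inter_comm (history X n ⁻¹' B)]
    refine (hmodel.transition n j B A hB hA).trans (lintegral_congr fun ω => ?_)
    refine lintegral_congr fun y => ?_
    simp only [history, Fin.val_last]
    split_ifs <;> rfl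
  rw [historyLaw, extend, ← hlaw, Measure.map_map measurable_snoc hpair]
  exact congrArg (Measure.map · _) (funext (history_succ n))

lemma historyLaw_singleton_succ {n j : ℕ} (hnj : n < j) :
    historyLaw P θ X n {j + 1} = (p : ℝ≥0∞) • historyLaw P θ X n {j} := by
  induction n with
  | zero =>
    obtain ⟨k, rfl⟩ := Nat.exists_eq_succ_of_ne_zero hnj.ne'
    have hgeom : P (θ ⁻¹' {k + 1 + 1}) = p * P (θ ⁻¹' {k + 1}) := by
      refine (hmodel.geometric (k + 1 + 1) (by omega)).trans ?_
      refine Eq.trans ?_ (congrArg _ (hmodel.geometric (k + 1) (by omega)).symm)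
      rw [Nat.add_sub_cancel, Nat.add_sub_cancel, pow_succ', mul_assoc, ENNReal.coe_mul]
    rw [historyLaw_zero hmodel, historyLaw_zero hmodel, smul_smul, ← hgeom]
  | succ n ih =>
    rw [historyLaw_succ_singleton hf0 hf1 hX hmodel, historyLaw_succ_singleton hf0 hf1 hX hmodel,
      if_pos hnj, if_pos (hnj.trans j.lt_succ_self), ih (n.lt_succ_self.trans hnj),
      extend_smul hf0]

lemma historyLaw_Ioi_succ_right {n m : ℕ} (hnm : n ≤ m) :
    historyLaw P θ X n (Set.Ioi (m + 1)) = (p : ℝ≥0∞) • historyLaw P θ X n (Set.Ioi m) := by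
  rw [historyLaw_Ioi_eq_sum hmodel.measurable_time hX,
    historyLaw_Ioi_eq_sum hmodel.measurable_time hX]
  refine Measure.ext_of_lintegral _ fun φ _ => ?_
  rw [lintegral_smul_measure, lintegral_sum_measure, lintegral_sum_measure, smul_eq_mul,
    ← ENNReal.tsum_mul_left]
  refine tsum_congr fun k => ?_
  rw [← smul_eq_mul, ← lintegral_smul_measure,
    ← historyLaw_singleton_succ hf0 hf1 hX hmodel (by omega), add_right_comm _ 1 k]

lemma historyLaw_Ioi_add (n d : ℕ) :
    historyLaw P θ X n (Set.Ioi (n + d)) =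
      (p : ℝ≥0∞) ^ d • historyLaw P θ X n (Set.Ioi n) := by
  induction d with
  | zero => simp
  | succ d ih =>
    rw [← add_assoc, historyLaw_Ioi_succ_right hf0 hf1 hX hmodel le_self_add, ih, smul_smul,
      pow_succ']

lemma historyLaw_succ_Ioi (n : ℕ) :
    historyLaw P θ X (n + 1) (Set.Ioi (n + 1)) =
      (p : ℝ≥0∞) • extend μ f0 (historyLaw P θ X n (Set.Ioi n)) := by
  rw [← extend_smul hf0, ← historyLaw_Ioi_succ_right hf0 hf1 hX hmodel le_rfl,
    historyLaw_Ioi_eq_sum hmodel.measurable_time hX,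
    historyLaw_Ioi_eq_sum hmodel.measurable_time hX, extend_sum hf0]
  refine congrArg _ (funext fun k => ?_)
  rw [historyLaw_succ_singleton hf0 hf1 hX hmodel, if_pos (by omega)]

variable (hpq : p + q = 1)

include hpq

lemma historyLaw_Ioc_add (n d : ℕ) :
    historyLaw P θ X n (Set.Ioc n (n + d)) =
      (1 - (p : ℝ≥0∞) ^ d) • historyLaw P θ X n (Set.Ioi n) := by
  have hp1 : (p : ℝ≥0∞) ≤ 1 := by exact_mod_cast hpq ▸ (le_self_add : p ≤ p + q)
  have hsplit := historyLaw_union (P := P) hmodel.measurable_time hX n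
    (Set.Ioc_disjoint_Ioi_same (a := n) (b := n + d))
  rw [Set.Ioc_union_Ioi_eq_Ioi le_self_add, historyLaw_Ioi_add hf0 hf1 hX hmodel] at hsplit
  have : SigmaFinite ((p : ℝ≥0∞) ^ d • historyLaw P θ X n (Set.Ioi n)) := by
    rw [← historyLaw_Ioi_add hf0 hf1 hX hmodel]
    infer_instance
  refine (Measure.add_left_inj ((p : ℝ≥0∞) ^ d • historyLaw P θ X n (Set.Ioi n)) _ _).1 ?_
  rw [← hsplit, ← add_smul, tsub_add_cancel_of_le (pow_le_one' hp1 d), one_smul]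

lemma historyLaw_singleton_add_one (n : ℕ) :
    historyLaw P θ X n {n + 1} = (q : ℝ≥0∞) • historyLaw P θ X n (Set.Ioi n) := by
  have hpq' : (p : ℝ≥0∞) + q = 1 := by exact_mod_cast hpq
  have hIoc : Set.Ioc n (n + 1) = {n + 1} := by
    ext j
    simp only [Set.mem_Ioc, Set.mem_singleton_iff]
    omega
  rw [← hIoc, historyLaw_Ioc_add hf0 hf1 hX hmodel hpq, pow_one, ← hpq',
    ENNReal.add_sub_cancel_left ENNReal.coe_ne_top]

lemma measure_time_pos (hq : q ≠ 0) : P (θ ⁻¹' Set.Ioi 0) = 1 := by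
  have hq' : (q : ℝ≥0∞) ≠ 0 := by simpa using hq
  have h := congrArg (· Set.univ) (historyLaw_singleton_add_one hf0 hf1 hX hmodel hpq 0)
  simp only [historyLaw_zero hmodel, Measure.smul_apply, measure_univ, smul_eq_mul, mul_one,
    zero_add] at h
  rw [show P (θ ⁻¹' {1}) = q from (hmodel.geometric 1 le_rfl).trans (by simp)] at h
  exact (ENNReal.mul_right_inj hq' ENNReal.coe_ne_top).1 (by rw [← h, mul_one])

end Transition

section Density

variable [IsFiniteMeasure P] [SigmaFinite μ] (hf0 : Measurable (Function.uncurry f0))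
  (hf1 : Measurable (Function.uncurry f1)) (hX : ∀ n, Measurable (X n))
  (hmodel : IsSwitchedProcess P μ p q f0 f1 x θ X) (hpq : p + q = 1) (hq : q ≠ 0)

include hf0 hf1 hX hmodel hpq hq

lemma lintegral_historyLaw_Ioi (n : ℕ) {φ : (Fin (n + 1) → E) → ℝ≥0∞} (hφ : Measurable φ) :
    ∫⁻ w, φ w ∂(historyLaw P θ X n (Set.Ioi n)) =
      (p : ℝ≥0∞) ^ n * ∫⁻ y : Fin n → E, φ (Fin.cons (α := fun _ => E) x y) *
        L f0 f1 0 (Fin.cons (α := fun _ => E) x y) ∂(Measure.pi fun _ => μ) := by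
  have hmeas (n : ℕ) {φ : (Fin (n + 1) → E) → ℝ≥0∞} (hφ : Measurable φ) :
      Measurable fun y => φ (Fin.cons (α := fun _ => E) x y) *
        (L f0 f1 0 (Fin.cons (α := fun _ => E) x y) : ℝ≥0∞) :=
    (hφ.mul (measurable_L hf0 hf1 0).coe_nnreal_ennreal).comp (measurable_cons x)
  induction n with
  | zero =>
    have hx (y : Fin 0 → E) : (Fin.cons (α := fun _ => E) x y : Fin 1 → E) = fun _ => x :=
      funext fun i => by rw [Fin.fin_one_eq_zero i, Fin.cons_zero]
    rw [historyLaw_zero hmodel, lintegral_smul_measure, lintegral_dirac' _ hφ,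
      measure_time_pos hf0 hf1 hX hmodel hpq hq, Measure.pi_of_empty,
      lintegral_dirac' _ (hmeas 0 hφ), hx]
    simp [L]
  | succ n ih =>
    rw [historyLaw_succ_Ioi hf0 hf1 hX hmodel, lintegral_smul_measure, lintegral_extend hf0 _ hφ,
      ih (measurable_stepMean hf0 hφ), lintegral_pi_snoc n (hmeas (n + 1) hφ), smul_eq_mul,
      pow_succ', mul_assoc]
    congr 2
    refine lintegral_congr fun w => ?_
    rw [stepMean, ← lintegral_mul_const' _ _ ENNReal.coe_ne_top]
    refine lintegral_congr fun y => ?_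
    rw [Fin.cons_snoc_eq_snoc_cons, L_zero_snoc, ENNReal.coe_mul]
    ring

lemma ae_L_ne_zero (n : ℕ) : ∀ᵐ w ∂(historyLaw P θ X n (Set.Ioi n)), L f0 f1 0 w ≠ 0 := by
  have hS : MeasurableSet {w : Fin (n + 1) → E | L f0 f1 0 w = 0} :=
    measurable_L hf0 hf1 0 (measurableSet_singleton 0)
  simp only [ae_iff, not_not]
  rw [← lintegral_indicator_one hS,
    lintegral_historyLaw_Ioi hf0 hf1 hX hmodel hpq hq n (measurable_one.indicator hS)]
  have hzero (w : Fin (n + 1) → E) :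
      {w : Fin (n + 1) → E | L f0 f1 0 w = 0}.indicator 1 w * (L f0 f1 0 w : ℝ≥0∞) = 0 := by
    by_cases hw : L f0 f1 0 w = 0 <;> simp [hw]
  simp only [hzero, lintegral_zero, mul_zero]

variable (hac : ∀ y, ∀ᵐ z ∂μ, f0 y z = 0 → f1 y z = 0) (hp : p ≠ 0)

include hac hp

lemma historyLaw_singleton_eq_withDensity (n m : ℕ) :
    historyLaw P θ X (n + m) {n + 1} =
      (q : ℝ≥0∞) • (historyLaw P θ X (n + m) (Set.Ioi (n + m))).withDensity
        (ratio p f0 f1 m) := by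
  induction m with
  | zero =>
    have hone : ratio p f0 f1 0 =ᵐ[historyLaw P θ X n (Set.Ioi n)] 1 := by
      filter_upwards [ae_L_ne_zero hf0 hf1 hX hmodel hpq hq n] with w hw using ratio_zero hw
    rw [add_zero, withDensity_congr_ae hone, withDensity_one,
      historyLaw_singleton_add_one hf0 hf1 hX hmodel hpq]
  | succ m ih =>
    rw [← add_assoc, historyLaw_succ_singleton hf0 hf1 hX hmodel, if_neg (by omega), ih,
      extend_smul hf1, extend_withDensity_ratio hf0 hf1 hac hp,
      historyLaw_succ_Ioi hf0 hf1 hX hmodel, withDensity_smul_measure]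

lemma historyLaw_Ioc_sub {n i : ℕ} (hin : i ≤ n) :
    historyLaw P θ X n (Set.Ioc (n - i) n) = (q : ℝ≥0∞) •
      (historyLaw P θ X n (Set.Ioi n)).withDensity
        fun w => ∑ m ∈ Finset.range i, ratio p f0 f1 (m + 1) w := by
  induction i with
  | zero => simp [historyLaw]
  | succ i ih =>
    obtain ⟨k, rfl⟩ := Nat.exists_eq_add_of_le' hin
    have hIoc : Set.Ioc (k + (i + 1) - (i + 1)) (k + (i + 1)) =
        Set.Ioc (k + (i + 1) - i) (k + (i + 1)) ∪ {k + 1} := by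
      ext j
      simp only [Set.mem_Ioc, Set.mem_union, Set.mem_singleton_iff]
      omega
    rw [hIoc, historyLaw_union hmodel.measurable_time hX _
        (Set.disjoint_singleton_right.2 fun h => by have := h.1; omega), ih (by omega),
      historyLaw_singleton_eq_withDensity hf0 hf1 hX hmodel hpq hq hac hp, ← smul_add,
      ← withDensity_add_right _ (measurable_ratio hf0 hf1 _)]
    simp only [Finset.sum_range_succ _ i, Pi.add_def]

lemma historyLaw_Icc_eq_withDensity {n d : ℕ} (hdn : d + 1 ≤ n) :
    historyLaw P θ X n (Set.Icc (n - d) (n + d)) =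
      (historyLaw P θ X n (Set.Ioi n)).withDensity fun w => 1 - (p : ℝ≥0∞) ^ d +
        q * ∑ m ∈ Finset.range (d + 1), ratio p f0 f1 (m + 1) w := by
  have hIcc : Set.Icc (n - d) (n + d) = Set.Ioc n (n + d) ∪ Set.Ioc (n - (d + 1)) n := by
    ext j
    simp only [Set.mem_Icc, Set.mem_union, Set.mem_Ioc]
    omega
  have hsum : Measurable fun w : Fin (n + 1) → E =>
      ∑ m ∈ Finset.range (d + 1), ratio p f0 f1 (m + 1) w :=
    Finset.measurable_sum _ fun m _ => measurable_ratio hf0 hf1 (m + 1)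
  rw [hIcc, historyLaw_union hmodel.measurable_time hX _
      (Set.disjoint_left.2 fun j hj hj' => hj.1.not_ge hj'.2),
    historyLaw_Ioc_add hf0 hf1 hX hmodel hpq,
    historyLaw_Ioc_sub hf0 hf1 hX hmodel hpq hq hac hp hdn, ← withDensity_const,
    ← withDensity_smul _ hsum, ← withDensity_add_left measurable_const]
  rfl

end Density

end SwitchedProcess

section Window

variable {E Ω : Type*} {p : ℝ≥0} {f0 f1 : E → E → ℝ≥0} {X : ℕ → Ω → E} {N n : ℕ} {ω : Ω}

/-- The window `X_{n-N}, …, X_n` of the last `N + 1` observations at time `n`; it is meaningful for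
`N ≤ n` only, because of the truncated subtraction. -/
def window (X : ℕ → Ω → E) (N n : ℕ) (ω : Ω) : Fin (N + 1) → E := fun i => X (n - N + i) ω

lemma window_self : window X n n ω = history X n ω := by
  funext i
  simp [window, history]

lemma tail_window (hN : N + 1 ≤ n) : Fin.tail (window X (N + 1) n ω) = window X N n ω := by
  funext i
  simp only [Fin.tail, window, Fin.val_succ]
  congr 1
  omega

lemma snoc_window (hN : N ≤ n) :
    Fin.snoc (α := fun _ => E) (window X N n ω) (X (n + 1) ω) = window X (N + 1) (n + 1) ω := by
  refine funext (Fin.lastCases ?_ fun i => ?_)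
  · simp only [Fin.snoc_last, window, Fin.val_last]
    congr 1
    omega
  · simp [window]

lemma window_last (hN : N ≤ n) : window X N n ω (Fin.last N) = X n ω := by
  simp [window, hN]

lemma L_window_ne_zero (hN : N ≤ n) (hω : L f0 f1 0 (history X n ω) ≠ 0) :
    L f0 f1 0 (window X N n ω) ≠ 0 := by
  induction hN using Nat.decreasingInduction with
  | self => rwa [window_self]
  | of_succ N hN ih =>
    rw [← tail_window hN]
    exact L_tail_ne_zero ih

lemma ratio_window (hN : N ≤ n) {m : ℕ} (hm : m ≤ N) (hω : L f0 f1 0 (history X n ω) ≠ 0) :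
    ratio p f0 f1 m (window X N n ω) = ratio p f0 f1 m (history X n ω) := by
  induction hN using Nat.decreasingInduction with
  | self => rw [window_self]
  | of_succ N hN ih =>
    rw [← tail_window hN, ratio_tail hm (L_window_ne_zero hN hω), ih (hm.trans N.le_succ)]

end Window

section Observation

variable {E Ω : Type*} [MeasurableSpace E] [MeasurableSpace Ω] {P : Measure Ω} {μ : Measure E}
  {p q : ℝ≥0} {f0 f1 : E → E → ℝ≥0} {x : E} {θ : Ω → ℕ} {X : ℕ → Ω → E}
  {hX : ∀ n, Measurable (X n)}

lemma observed_eq_comap_history (n : ℕ) :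
    observed X hX n = MeasurableSpace.comap (history X n) inferInstance := by
  refine le_antisymm (iSup₂_le fun j hj => ?_) ?_
  · exact ((measurable_pi_apply (⟨j, by omega⟩ : Fin (n + 1))).comp
      (comap_measurable (history X n))).comap_le
  · simp only [MeasurableSpace.pi, MeasurableSpace.comap_iSup, MeasurableSpace.comap_comp]
    exact iSup_le fun i => le_iSup₂_of_le (i : ℕ) (by omega) le_rfl

lemma measurable_observed_window {N n : ℕ} (hN : N ≤ n) :
    Measurable[observed X hX n] (window X N n) := by
  refine @measurable_pi_lambda _ _ _ (observed X hX n) _ _ fun i => Measurable.of_comap_le ?_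
  exact le_iSup₂_of_le (n - N + i) (by omega) le_rfl

variable [IsFiniteMeasure P] (hmodel : IsSwitchedProcess P μ p q f0 f1 x θ X)

include hmodel

lemma lintegral_history_succ [SFinite μ] (hf0 : Measurable (Function.uncurry f0))
    (hf1 : Measurable (Function.uncurry f1)) (hX : ∀ n, Measurable (X n)) (n : ℕ)
    {φ : (Fin (n + 1) → E) → E → ℝ≥0∞} (hφ : Measurable (Function.uncurry φ)) :
    ∫⁻ ω in θ ⁻¹' Set.Ioi (n + 1), φ (history X n ω) (X (n + 1) ω) ∂P =
      p * ∫⁻ ω in θ ⁻¹' Set.Ioi n, ∫⁻ y, f0 (X n ω) y * φ (history X n ω) y ∂μ ∂P := by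
  let ψ : (Fin (n + 2) → E) → ℝ≥0∞ := fun v => φ (Fin.init v) (v (Fin.last (n + 1)))
  have hψ : Measurable ψ := hφ.comp
    ((measurable_pi_lambda _ fun i => measurable_pi_apply i.castSucc).prodMk
      (measurable_pi_apply _))
  have hstep : stepMean μ f0 ψ = fun w => ∫⁻ y, f0 (w (Fin.last n)) y * φ w y ∂μ :=
    funext fun w => by simp only [stepMean, ψ, Fin.init_snoc, Fin.snoc_last]
  have h := lintegral_historyLaw (P := P) (θ := θ) hX (n + 1) (Set.Ioi (n + 1)) hψ
  rw [historyLaw_succ_Ioi hf0 hf1 hX hmodel, lintegral_smul_measure, lintegral_extend hf0 _ hψ,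
    lintegral_historyLaw hX _ _ (measurable_stepMean hf0 hψ), hstep] at h
  exact h.symm

lemma setLIntegral_window_succ [SFinite μ] (hf0 : Measurable (Function.uncurry f0))
    (hf1 : Measurable (Function.uncurry f1)) {N n : ℕ} (hN : N ≤ n) {S : Set Ω}
    (hS : MeasurableSet[observed X hX n] S) {φ : (Fin (N + 2) → E) → ℝ≥0∞} (hφ : Measurable φ) :
    ∫⁻ ω in S ∩ θ ⁻¹' Set.Ioi (n + 1), φ (window X (N + 1) (n + 1) ω) ∂P =
      p * ∫⁻ ω in S ∩ θ ⁻¹' Set.Ioi n, stepMean μ f0 φ (window X N n ω) ∂P := by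
  have hSΩ := (observed X hX).le n S hS
  rw [observed_eq_comap_history] at hS
  obtain ⟨B, hB, rfl⟩ := hS
  let last : (Fin (n + 1) → E) → Fin (N + 1) → E := fun w i => w ⟨n - N + i, by omega⟩
  let ψ : (Fin (n + 1) → E) → E → ℝ≥0∞ := fun w y =>
    B.indicator (fun w => φ (Fin.snoc (α := fun _ => E) (last w) y)) w
  have hlast : Measurable last := measurable_pi_lambda _ fun i => measurable_pi_apply _
  have hψ : Measurable (Function.uncurry ψ) :=
    (hφ.comp (measurable_snoc.comp (hlast.prodMap measurable_id))).indicator (measurable_fst hB)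
  rw [← setLIntegral_indicator hSΩ, ← setLIntegral_indicator hSΩ]
  convert lintegral_history_succ hmodel hf0 hf1 hX n hψ using 4 with ω ω
  · simp only [ψ, Set.indicator, Set.mem_preimage, ← snoc_window hN]
    rfl
  · by_cases hω : history X n ω ∈ B
    · simp [ψ, hω, stepMean, window_last hN]
      rfl
    · simp [ψ, hω]

section Density

variable [SigmaFinite μ] (hf0 : Measurable (Function.uncurry f0))
  (hf1 : Measurable (Function.uncurry f1)) (hpq : p + q = 1) (hq : q ≠ 0)

include hf0 hf1 hpq hq

lemma ae_L_history_ne_zero (hX : ∀ n, Measurable (X n)) (n : ℕ) :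
    ∀ᵐ ω ∂P.restrict (θ ⁻¹' Set.Ioi n), L f0 f1 0 (history X n ω) ≠ 0 :=
  ae_of_ae_map (measurable_history hX n).aemeasurable
    (ae_L_ne_zero hf0 hf1 hX hmodel hpq hq n)

variable (hac : ∀ y, ∀ᵐ z ∂μ, f0 y z = 0 → f1 y z = 0) (hp : p ≠ 0)

include hac hp

lemma measure_inter_time_mem_Icc {n d : ℕ} (hdn : d + 1 ≤ n) {S : Set Ω}
    (hS : MeasurableSet[observed X hX n] S) :
    P (S ∩ θ ⁻¹' Set.Icc (n - d) (n + d)) =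
      ∫⁻ ω in S ∩ θ ⁻¹' Set.Ioi n, statistic p q f0 f1 d (window X (d + 1) n ω) ∂P := by
  rw [observed_eq_comap_history] at hS
  obtain ⟨B, hB, rfl⟩ := hS
  have hdens : Measurable fun w : Fin (n + 1) → E => 1 - (p : ℝ≥0∞) ^ d +
      q * ∑ m ∈ Finset.range (d + 1), ratio p f0 f1 (m + 1) w :=
    ((Finset.measurable_sum _ fun m _ => measurable_ratio hf0 hf1 _).const_mul _).const_add _
  rw [← historyLaw_apply hX _ _ hB,
    historyLaw_Icc_eq_withDensity hf0 hf1 hX hmodel hpq hq hac hp hdn, withDensity_apply _ hB,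
    setLIntegral_historyLaw hX _ _ hB hdens]
  refine lintegral_congr_ae (ae_restrict_of_ae_restrict_of_subset Set.inter_subset_right ?_)
  filter_upwards [ae_L_history_ne_zero hmodel hf0 hf1 hpq hq hX n] with ω hω
  rw [statistic_eq_sum_range, Finset.sum_congr rfl fun m hm =>
    ratio_window hdn (Nat.succ_le_of_lt (Finset.mem_range.1 hm)) hω]

end Density

lemma lintegral_rStar_window_le [SigmaFinite μ] (hf0 : IsTransitionDensity μ f0)
    (hf1 : IsTransitionDensity μ f1) (hX : ∀ n, Measurable (X n))
    (hac : ∀ y, ∀ᵐ z ∂μ, f0 y z = 0 → f1 y z = 0)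
    (hp : p ≠ 0) (hq : q ≠ 0) (hpq : p + q = 1) {n d : ℕ} (hdn : d ≤ n) :
    ∫⁻ ω in θ ⁻¹' Set.Ioi n, rStar μ p q f0 f1 d (window X d n ω) ∂P ≤
      P (θ ⁻¹' Set.Ioi (n - d)) := by
  have hsum : Measurable fun w : Fin (n + 1) → E =>
      ∑ m ∈ Finset.range d, ratio p f0 f1 (m + 1) w :=
    Finset.measurable_sum _ fun m _ => measurable_ratio hf0.measurable hf1.measurable (m + 1)
  calc ∫⁻ ω in θ ⁻¹' Set.Ioi n, rStar μ p q f0 f1 d (window X d n ω) ∂P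
    _ ≤ ∫⁻ ω in θ ⁻¹' Set.Ioi n,
          (1 + q * ∑ m ∈ Finset.range d, ratio p f0 f1 (m + 1) (history X n ω)) ∂P := by
      refine lintegral_mono_ae ?_
      filter_upwards [ae_L_history_ne_zero hmodel hf0.measurable hf1.measurable hpq hq hX n]
        with ω hω
      have hωd := L_window_ne_zero hdn hω
      refine (rStar_le hf0 hf1 hac hp hpq d hωd).trans_eq ?_
      rw [add_mul_sum_range_ratio hpq d hωd, Finset.sum_congr rfl fun m hm =>
        ratio_window hdn (Nat.succ_le_of_lt (Finset.mem_range.1 hm)) hω]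
    _ = historyLaw P θ X n (Set.Ioc (n - d) n ∪ Set.Ioi n) Set.univ := by
      rw [historyLaw_union hmodel.measurable_time hX n Set.Ioc_disjoint_Ioi_same,
        historyLaw_Ioc_sub hf0.measurable hf1.measurable hX hmodel hpq hq hac hp hdn,
        ← withDensity_smul _ hsum, Measure.add_apply, withDensity_apply _ MeasurableSet.univ,
        Measure.restrict_univ, lintegral_historyLaw hX _ _ (hsum.const_smul _), ← lintegral_one,
        lintegral_historyLaw hX _ _ measurable_const, add_comm,
        ← lintegral_add_left measurable_const]
      rfl
    _ = P (θ ⁻¹' Set.Ioi (n - d)) := by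
      rw [Set.Ioc_union_Ioi_eq_Ioi (Nat.sub_le n d), historyLaw_apply hX _ _ MeasurableSet.univ,
        Set.preimage_univ, Set.univ_inter]

lemma setLIntegral_optimalPayoff_window_succ [SigmaFinite μ] (hf0 : IsTransitionDensity μ f0)
    (hf1 : IsTransitionDensity μ f1) (hac : ∀ y, ∀ᵐ z ∂μ, f0 y z = 0 → f1 y z = 0) (hp : p ≠ 0)
    {n d : ℕ} (hdn : d ≤ n) {S : Set Ω} (hS : MeasurableSet[observed X hX n] S) :
    ∫⁻ ω in S ∩ θ ⁻¹' Set.Ioi (n + 1),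
        optimalPayoff μ p q f0 f1 d (window X (d + 1) (n + 1) ω) ∂P =
      ∫⁻ ω in S ∩ θ ⁻¹' Set.Ioi n, rStar μ p q f0 f1 d (window X d n ω) ∂P := by
  rw [setLIntegral_window_succ hmodel hf0.measurable hf1.measurable hdn hS
    (measurable_optimalPayoff hf0 hf1 hac hp d), ← lintegral_const_mul' _ _ ENNReal.coe_ne_top]
  simp only [rStar_eq_mul_stepMean hf0 hf1 hac hp]

end Observation

section Detection

variable {Ω : Type*} {d : ℕ} {θ : Ω → ℕ} {τ : Ω → ℕ∞}

lemma detection_eq_iUnion {s : ℕ} (hτ : ∀ ω, s ≤ τ ω) :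
    detection d θ τ =
      ⋃ i : ℕ, τ ⁻¹' {((s + i : ℕ) : ℕ∞)} ∩ θ ⁻¹' Set.Icc (s + i - d) (s + i + d) := by
  have habs (n : ℕ) (ω : Ω) : |(θ ω : ℤ) - n| ≤ d ↔ θ ω ∈ Set.Icc (n - d) (n + d) := by
    rw [abs_le, Set.mem_Icc]
    omega
  ext ω
  simp only [detection, habs, Set.mem_ofPred_eq, Set.mem_iUnion]
  constructor
  · rintro ⟨n, hn, hω⟩
    obtain ⟨i, rfl⟩ := Nat.exists_eq_add_of_le (Nat.cast_le.1 ((hτ ω).trans_eq hn))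
    exact ⟨i, hn, hω⟩
  · rintro ⟨i, hi, hω⟩
    exact ⟨s + i, hi, hω⟩

lemma measure_detection_eq_tsum [MeasurableSpace Ω] {P : Measure Ω} (hθ : Measurable θ) {s : ℕ}
    (hτ : ∀ ω, s ≤ τ ω) (hτm : ∀ n : ℕ, MeasurableSet (τ ⁻¹' {(n : ℕ∞)})) :
    P (detection d θ τ) =
      ∑' i : ℕ, P (τ ⁻¹' {((s + i : ℕ) : ℕ∞)} ∩ θ ⁻¹' Set.Icc (s + i - d) (s + i + d)) := by
  rw [detection_eq_iUnion hτ]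
  refine measure_iUnion (fun i j hij => ?_) fun i => (hτm _).inter (hθ measurableSet_Icc)
  refine Disjoint.mono Set.inter_subset_left Set.inter_subset_left (Disjoint.preimage τ ?_)
  simpa using hij

lemma detection_inter_subset_detection_max :
    detection d θ τ ∩ θ ⁻¹' Set.Ioi 0 ⊆ detection d θ fun ω => max (τ ω) (d + 1 : ℕ) := by
  rintro ω ⟨⟨n, hn, hω⟩, hpos⟩
  refine ⟨max n (d + 1), ?_, ?_⟩
  · simp only [hn]
    exact (Nat.mono_cast (α := ℕ∞)).map_max.symm
  · rw [abs_le] at hω ⊢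
    rw [Set.mem_preimage, Set.mem_Ioi] at hpos
    omega

end Detection

section Telescope

variable {u v : ℕ → ℝ≥0∞}

lemma tsum_le_of_add_succ_le (h : ∀ n, u n + v (n + 1) ≤ v n) : ∑' n, u n ≤ v 0 := by
  have hsum (n : ℕ) : ∑ i ∈ Finset.range n, u i + v n ≤ v 0 := by
    induction n with
    | zero => simp
    | succ n ih =>
      rw [Finset.sum_range_succ, add_assoc]
      exact (add_le_add_right (h n) _).trans ih
  exact ENNReal.tsum_le_of_sum_range_le fun n => le_self_add.trans (hsum n)

lemma tsum_eq_of_add_succ_eq (h : ∀ n, u n + v (n + 1) = v n) (hv : Tendsto v atTop (𝓝 0)) :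
    ∑' n, u n = v 0 := by
  have hsum (n : ℕ) : ∑ i ∈ Finset.range n, u i + v n = v 0 := by
    induction n with
    | zero => simp
    | succ n ih => rw [Finset.sum_range_succ, add_assoc, h n, ih]
  have hlim := (ENNReal.tendsto_nat_tsum u).add hv
  simp only [hsum, add_zero] at hlim
  exact tendsto_nhds_unique hlim tendsto_const_nhds

end Telescope

section Optimality

variable {E Ω : Type*} [MeasurableSpace E] [MeasurableSpace Ω] {P : Measure Ω} {μ : Measure E}
  {p q : ℝ≥0} {f0 f1 : E → E → ℝ≥0} {x : E} {θ : Ω → ℕ} {X : ℕ → Ω → E}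
  {hX : ∀ n, Measurable (X n)} {d n : ℕ} {τ : Ω → ℕ∞}

/-- The detection probability collected on `{n ≤ τ}` by playing optimally from time `n` on. It is an
integral over `{n < θ}` because the payoffs are densities with respect to the law of the
observations on that event. -/
noncomputable def remainingValue (P : Measure Ω) (μ : Measure E) (p q : ℝ≥0)
    (f0 f1 : E → E → ℝ≥0) (d : ℕ) (θ : Ω → ℕ) (X : ℕ → Ω → E) (τ : Ω → ℕ∞) (n : ℕ) : ℝ≥0∞ :=
  ∫⁻ ω in τ ⁻¹' Set.Ici (n : ℕ∞) ∩ θ ⁻¹' Set.Ioi n,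
    optimalPayoff μ p q f0 f1 d (window X (d + 1) n ω) ∂P

lemma remainingValue_of_le (hτ : ∀ ω, n ≤ τ ω) :
    remainingValue P μ p q f0 f1 d θ X τ n =
      ∫⁻ ω in θ ⁻¹' Set.Ioi n, optimalPayoff μ p q f0 f1 d (window X (d + 1) n ω) ∂P := by
  rw [remainingValue, (Set.eq_univ_of_forall hτ : τ ⁻¹' Set.Ici (n : ℕ∞) = Set.univ),
    Set.univ_inter]

lemma remainingValue_eq_add (hθ : Measurable θ) (hτ : IsStoppingTime (observed X hX) τ) :
    remainingValue P μ p q f0 f1 d θ X τ n =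
      ∫⁻ ω in τ ⁻¹' {(n : ℕ∞)} ∩ θ ⁻¹' Set.Ioi n,
          optimalPayoff μ p q f0 f1 d (window X (d + 1) n ω) ∂P +
        ∫⁻ ω in τ ⁻¹' Set.Ioi (n : ℕ∞) ∩ θ ⁻¹' Set.Ioi n,
          optimalPayoff μ p q f0 f1 d (window X (d + 1) n ω) ∂P := by
  have hgt : MeasurableSet (τ ⁻¹' Set.Ioi (n : ℕ∞)) :=
    (observed X hX).le n _ (hτ.measurableSet_gt n)
  rw [remainingValue, ← Set.Ioi_insert, Set.insert_eq, Set.preimage_union,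
    Set.union_inter_distrib_right]
  refine lintegral_union (hgt.inter (hθ measurableSet_Ioi)) ?_
  refine Disjoint.mono Set.inter_subset_left Set.inter_subset_left (Disjoint.preimage τ ?_)
  simp

variable [IsFiniteMeasure P] [SigmaFinite μ] (hmodel : IsSwitchedProcess P μ p q f0 f1 x θ X)
  (hf0 : IsTransitionDensity μ f0) (hf1 : IsTransitionDensity μ f1)
  (hac : ∀ y, ∀ᵐ z ∂μ, f0 y z = 0 → f1 y z = 0) (hp : p ≠ 0)

include hmodel hf0 hf1 hac hp

lemma remainingValue_succ (hdn : d ≤ n) (hτ : IsStoppingTime (observed X hX) τ) :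
    remainingValue P μ p q f0 f1 d θ X τ (n + 1) =
      ∫⁻ ω in τ ⁻¹' Set.Ioi (n : ℕ∞) ∩ θ ⁻¹' Set.Ioi n,
        rStar μ p q f0 f1 d (window X d n ω) ∂P := by
  have hIci : Set.Ici ((n + 1 : ℕ) : ℕ∞) = Set.Ioi (n : ℕ∞) :=
    Set.ext fun _ => ENat.add_one_le_iff (ENat.natCast_ne_top n)
  rw [remainingValue, hIci]
  exact setLIntegral_optimalPayoff_window_succ hmodel hf0 hf1 hac hp hdn (hτ.measurableSet_gt n)

variable (hq : q ≠ 0) (hpq : p + q = 1)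

include hq hpq

lemma measure_detection_at_add_remainingValue_succ (hdn : d + 1 ≤ n)
    (hτ : IsStoppingTime (observed X hX) τ) :
    P (τ ⁻¹' {(n : ℕ∞)} ∩ θ ⁻¹' Set.Icc (n - d) (n + d)) +
        remainingValue P μ p q f0 f1 d θ X τ (n + 1) =
      ∫⁻ ω in τ ⁻¹' {(n : ℕ∞)} ∩ θ ⁻¹' Set.Ioi n,
          statistic p q f0 f1 d (window X (d + 1) n ω) ∂P +
        ∫⁻ ω in τ ⁻¹' Set.Ioi (n : ℕ∞) ∩ θ ⁻¹' Set.Ioi n,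
          rStar μ p q f0 f1 d (window X d n ω) ∂P := by
  rw [remainingValue_succ hmodel hf0 hf1 hac hp (Nat.le_of_succ_le hdn) hτ]
  congr 1
  exact measure_inter_time_mem_Icc hmodel hf0.measurable hf1.measurable hpq hq hac hp hdn
    (hτ.measurableSet_eq n)

lemma measure_detection_at_add_remainingValue_succ_le (hdn : d + 1 ≤ n)
    (hτ : IsStoppingTime (observed X hX) τ) :
    P (τ ⁻¹' {(n : ℕ∞)} ∩ θ ⁻¹' Set.Icc (n - d) (n + d)) +
        remainingValue P μ p q f0 f1 d θ X τ (n + 1) ≤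
      remainingValue P μ p q f0 f1 d θ X τ n := by
  rw [measure_detection_at_add_remainingValue_succ hmodel hf0 hf1 hac hp hq hpq hdn hτ,
    remainingValue_eq_add hmodel.measurable_time hτ]
  refine add_le_add (lintegral_mono fun ω => le_max_left _ _) (lintegral_mono fun ω => ?_)
  exact (congrArg _ (tail_window hdn)).ge.trans (le_max_right _ _)

lemma measure_detection_le_remainingValue (hτ : IsStoppingTime (observed X hX) τ)
    (hdτ : ∀ ω, (d + 1 : ℕ) ≤ τ ω) :
    P (detection d θ τ) ≤ remainingValue P μ p q f0 f1 d θ X τ (d + 1) := by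
  rw [measure_detection_eq_tsum hmodel.measurable_time hdτ fun n =>
    (observed X hX).le n _ (hτ.measurableSet_eq n)]
  exact tsum_le_of_add_succ_le (v := fun i => remainingValue P μ p q f0 f1 d θ X τ (d + 1 + i))
    fun i => measure_detection_at_add_remainingValue_succ_le hmodel hf0 hf1 hac hp hq hpq
      (Nat.le_add_right _ _) hτ

lemma remainingValue_succ_le (hdn : d ≤ n) (hτ : IsStoppingTime (observed X hX) τ) :
    remainingValue P μ p q f0 f1 d θ X τ (n + 1) ≤ P (θ ⁻¹' Set.Ioi (n - d)) := by
  rw [remainingValue_succ hmodel hf0 hf1 hac hp hdn hτ]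
  exact (lintegral_mono_set Set.inter_subset_right).trans
    (lintegral_rStar_window_le hmodel hf0 hf1 hX hac hp hq hpq hdn)

lemma tendsto_remainingValue (hτ : IsStoppingTime (observed X hX) τ) :
    Tendsto (remainingValue P μ p q f0 f1 d θ X τ) atTop (𝓝 0) := by
  have htail : Tendsto (fun n => P (θ ⁻¹' Set.Ioi n)) atTop (𝓝 0) := by
    have hinter : ⋂ n, θ ⁻¹' Set.Ioi n = ∅ :=
      Set.eq_empty_of_forall_notMem fun ω hω => lt_irrefl (θ ω) (Set.mem_iInter.1 hω (θ ω))
    rw [← measure_empty (μ := P), ← hinter]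
    exact tendsto_measure_iInter_atTop
      (fun n => (hmodel.measurable_time measurableSet_Ioi).nullMeasurableSet)
      (fun m n hmn => Set.preimage_mono (Set.Ioi_subset_Ioi hmn)) ⟨0, measure_ne_top _ _⟩
  refine (tendsto_add_atTop_iff_nat (d + 1)).1 (tendsto_of_tendsto_of_tendsto_of_le_of_le
    tendsto_const_nhds htail (fun _ => zero_le) fun n => ?_)
  have hle := remainingValue_succ_le hmodel hf0 hf1 hac hp hq hpq (Nat.le_add_left d n) hτ
  rwa [Nat.add_sub_cancel] at hle

end Optimality

section TauStar

variable {E Ω : Type*} [MeasurableSpace E] {μ : Measure E} {p q : ℝ≥0} {f0 f1 : E → E → ℝ≥0}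
  {X : ℕ → Ω → E} {d n : ℕ} {ω : Ω}

lemma tauStar_le_iff :
    tauStar μ p q f0 f1 d X ω ≤ n ↔ ∃ k ≤ n, d + 1 ≤ k ∧
      rStar μ p q f0 f1 d (window X d k ω) ≤ statistic p q f0 f1 d (window X (d + 1) k ω) := by
  rw [← ENat.lt_add_one_iff (ENat.natCast_ne_top n), tauStar, sInf_lt_iff]
  constructor
  · rintro ⟨_, ⟨k, rfl, hdk, hk⟩, hkn⟩
    exact ⟨k, Nat.lt_succ_iff.1 (by exact_mod_cast hkn), hdk, hk⟩
  · rintro ⟨k, hkn, hdk, hk⟩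
    exact ⟨k, ⟨k, rfl, hdk, hk⟩, by exact_mod_cast Nat.lt_succ_iff.2 hkn⟩

lemma le_tauStar : ((d + 1 : ℕ) : ℕ∞) ≤ tauStar μ p q f0 f1 d X ω := by
  refine le_sInf ?_
  rintro _ ⟨n, rfl, hn, -⟩
  exact Nat.cast_le.2 hn

lemma rStar_le_statistic_of_tauStar_eq (h : tauStar μ p q f0 f1 d X ω = n) :
    rStar μ p q f0 f1 d (window X d n ω) ≤ statistic p q f0 f1 d (window X (d + 1) n ω) := by
  obtain ⟨k, hkn, hdk, hk⟩ := tauStar_le_iff.1 h.le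
  have hnk : (n : ℕ∞) ≤ k := h.ge.trans (tauStar_le_iff.2 ⟨k, le_rfl, hdk, hk⟩)
  rwa [hkn.antisymm (Nat.cast_le.1 hnk)] at hk

lemma statistic_lt_rStar_of_lt_tauStar (hn : d + 1 ≤ n) (h : n < tauStar μ p q f0 f1 d X ω) :
    statistic p q f0 f1 d (window X (d + 1) n ω) < rStar μ p q f0 f1 d (window X d n ω) :=
  not_le.1 fun hle => h.not_ge (tauStar_le_iff.2 ⟨n, le_rfl, hn, hle⟩)

variable [MeasurableSpace Ω] {hX : ∀ n, Measurable (X n)}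

lemma isStoppingTime_tauStar [SFinite μ] (hf0 : IsTransitionDensity μ f0)
    (hf1 : IsTransitionDensity μ f1) (hac : ∀ y, ∀ᵐ z ∂μ, f0 y z = 0 → f1 y z = 0) (hp : p ≠ 0) :
    IsStoppingTime (observed X hX) (tauStar μ p q f0 f1 d X) := by
  intro n
  have hset : {ω | tauStar μ p q f0 f1 d X ω ≤ (n : ℕ∞)} =
      ⋃ k ∈ Set.Icc (d + 1) n, {ω | rStar μ p q f0 f1 d (window X d k ω) ≤
        statistic p q f0 f1 d (window X (d + 1) k ω)} := by
    ext ω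
    simp only [Set.mem_ofPred_eq, tauStar_le_iff, Set.mem_iUnion, exists_prop, Set.mem_Icc]
    exact exists_congr fun k => by tauto
  change MeasurableSet[observed X hX n] {ω | tauStar μ p q f0 f1 d X ω ≤ (n : ℕ∞)}
  rw [hset]
  refine MeasurableSet.biUnion (Set.to_countable _) fun k hk => (observed X hX).mono hk.2 _ ?_
  exact measurableSet_le
    ((measurable_rStar hf0 hf1 hac hp d).comp
      (measurable_observed_window (Nat.le_of_succ_le hk.1)))
    ((measurable_statistic hf0.measurable hf1.measurable d).comp (measurable_observed_window hk.1))

variable {P : Measure Ω} {x : E} {θ : Ω → ℕ} [SigmaFinite μ]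
  (hf0 : IsTransitionDensity μ f0) (hf1 : IsTransitionDensity μ f1)
  (hac : ∀ y, ∀ᵐ z ∂μ, f0 y z = 0 → f1 y z = 0) (hp : p ≠ 0) (hq : q ≠ 0) (hpq : p + q = 1)

include hf0 hf1 hac hp hq hpq

lemma measure_detection_tauStar_at_add_remainingValue_succ [IsFiniteMeasure P]
    (hmodel : IsSwitchedProcess P μ p q f0 f1 x θ X) (hX : ∀ n, Measurable (X n))
    (hdn : d + 1 ≤ n) :
    P (tauStar μ p q f0 f1 d X ⁻¹' {(n : ℕ∞)} ∩ θ ⁻¹' Set.Icc (n - d) (n + d)) +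
        remainingValue P μ p q f0 f1 d θ X (tauStar μ p q f0 f1 d X) (n + 1) =
      remainingValue P μ p q f0 f1 d θ X (tauStar μ p q f0 f1 d X) n := by
  have hτ := isStoppingTime_tauStar (q := q) (d := d) (hX := hX) hf0 hf1 hac hp
  rw [measure_detection_at_add_remainingValue_succ hmodel hf0 hf1 hac hp hq hpq hdn hτ,
    remainingValue_eq_add hmodel.measurable_time hτ]
  simp only [optimalPayoff, tail_window hdn]
  have hθ : MeasurableSet (θ ⁻¹' Set.Ioi n) := hmodel.measurable_time measurableSet_Ioi
  congr 1
  · refine setLIntegral_congr_fun (((observed X hX).le n _ (hτ.measurableSet_eq n)).inter hθ) ?_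
    exact fun ω hω => (max_eq_left (rStar_le_statistic_of_tauStar_eq hω.1)).symm
  · refine setLIntegral_congr_fun (((observed X hX).le n _ (hτ.measurableSet_gt n)).inter hθ) ?_
    exact fun ω hω => (max_eq_right (statistic_lt_rStar_of_lt_tauStar hdn hω.1).le).symm

lemma measure_detection_tauStar_eq_setLIntegral [IsFiniteMeasure P]
    (hmodel : IsSwitchedProcess P μ p q f0 f1 x θ X) (hX : ∀ n, Measurable (X n)) :
    P (detection d θ (tauStar μ p q f0 f1 d X)) =
      ∫⁻ ω in θ ⁻¹' Set.Ioi (d + 1),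
        optimalPayoff μ p q f0 f1 d (window X (d + 1) (d + 1) ω) ∂P := by
  have hτ := isStoppingTime_tauStar (q := q) (d := d) (hX := hX) hf0 hf1 hac hp
  have hdτ (ω : Ω) : (d + 1 : ℕ) ≤ tauStar μ p q f0 f1 d X ω := le_tauStar
  rw [← remainingValue_of_le hdτ, measure_detection_eq_tsum hmodel.measurable_time hdτ
    fun n => (observed X hX).le n _ (hτ.measurableSet_eq n)]
  refine tsum_eq_of_add_succ_eq
    (v := fun i => remainingValue P μ p q f0 f1 d θ X (tauStar μ p q f0 f1 d X) (d + 1 + i))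
    (fun i => measure_detection_tauStar_at_add_remainingValue_succ hf0 hf1 hac hp hq hpq hmodel hX
      (Nat.le_add_right _ _)) ?_
  simp only [add_comm (d + 1)]
  exact (tendsto_add_atTop_iff_nat (d + 1)).2
    (tendsto_remainingValue hmodel hf0 hf1 hac hp hq hpq hτ)

lemma measure_detection_tauStar [IsFiniteMeasure P]
    (hmodel : IsSwitchedProcess P μ p q f0 f1 x θ X) (hX : ∀ n, Measurable (X n)) :
    P (detection d θ (tauStar μ p q f0 f1 d X)) =
      (p : ℝ≥0∞) ^ (d + 1) * ∫⁻ y : Fin (d + 1) → E,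
        max (statistic p q f0 f1 d (Fin.cons (α := fun _ => E) x y)) (rStar μ p q f0 f1 d y) *
          L f0 f1 0 (Fin.cons (α := fun _ => E) x y) ∂Measure.pi fun _ => μ := by
  rw [measure_detection_tauStar_eq_setLIntegral hf0 hf1 hac hp hq hpq hmodel hX]
  simp only [window_self]
  rw [← lintegral_historyLaw hX _ _ (measurable_optimalPayoff hf0 hf1 hac hp d),
    lintegral_historyLaw_Ioi hf0.measurable hf1.measurable hX hmodel hpq hq _
      (measurable_optimalPayoff hf0 hf1 hac hp d)]
  simp only [optimalPayoff, Fin.tail_cons]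

lemma measure_detection_le_tauStar [IsProbabilityMeasure P]
    (hmodel : IsSwitchedProcess P μ p q f0 f1 x θ X) {τ : Ω → ℕ∞}
    (hτ : IsStoppingTime (observed X hX) τ) :
    P (detection d θ τ) ≤ P (detection d θ (tauStar μ p q f0 f1 d X)) := by
  have hpos : ∀ᵐ ω ∂P, ω ∈ θ ⁻¹' Set.Ioi 0 :=
    (mem_ae_iff_prob_eq_one (hmodel.measurable_time measurableSet_Ioi)).2
      (measure_time_pos hf0.measurable hf1.measurable hX hmodel hpq hq)
  calc P (detection d θ τ)
    _ ≤ P (detection d θ fun ω => max (τ ω) (d + 1 : ℕ)) :=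
      measure_mono_ae (hpos.mono fun ω hω h => detection_inter_subset_detection_max ⟨h, hω⟩)
    _ ≤ remainingValue P μ p q f0 f1 d θ X (fun ω => max (τ ω) (d + 1 : ℕ)) (d + 1) :=
      measure_detection_le_remainingValue hmodel hf0 hf1 hac hp hq hpq (hτ.max_const (d + 1))
        fun ω => le_max_right _ _
    _ = P (detection d θ (tauStar μ p q f0 f1 d X)) := by
      rw [remainingValue_of_le fun ω => le_max_right _ _,
        measure_detection_tauStar_eq_setLIntegral hf0 hf1 hac hp hq hpq hmodel hX]

lemma measure_detection_tauStar_eq_iSup [IsProbabilityMeasure P]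
    (hmodel : IsSwitchedProcess P μ p q f0 f1 x θ X) :
    P (detection d θ (tauStar μ p q f0 f1 d X)) =
      ⨆ (τ : Ω → ℕ∞) (_ : IsStoppingTime (observed X hX) τ), P (detection d θ τ) :=
  le_antisymm
    (le_iSup₂_of_le (f := fun τ (_ : IsStoppingTime (observed X hX) τ) => P (detection d θ τ)) _
      (isStoppingTime_tauStar hf0 hf1 hac hp) le_rfl)
    (iSup₂_le fun _ => measure_detection_le_tauStar hf0 hf1 hac hp hq hpq hmodel)

end TauStar

end DisorderDetection

theorem mainTheorem1 {E Ω : Type*} [MeasurableSpace E] [MeasurableSpace Ω]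
    (P : Measure Ω) [IsProbabilityMeasure P] (μ : Measure E) [SigmaFinite μ]
    (p q : ℝ≥0) (hp : 0 < p) (hq : 0 < q) (hpq : p + q = 1)
    (f0 f1 : E → E → ℝ≥0)
    (hf0 : DisorderDetection.IsTransitionDensity μ f0)
    (hf1 : DisorderDetection.IsTransitionDensity μ f1)
    (hac : ∀ y, ∀ᵐ z ∂μ, f0 y z = 0 → f1 y z = 0)
    (x : E) (θ : Ω → ℕ) (X : ℕ → Ω → E) (hX : ∀ n, Measurable (X n))
    (hmodel : DisorderDetection.IsSwitchedProcess P μ p q f0 f1 x θ X) (d : ℕ) :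
    -- the thresholds converge, and the limit is finite wherever `L_0` does not vanish
    (∀ w : Fin (d + 1) → E,
      Tendsto (fun k => DisorderDetection.threshold μ p q f0 f1 d k w) atTop
        (𝓝 (DisorderDetection.rStar μ p q f0 f1 d w)) ∧
      (DisorderDetection.L f0 f1 0 w ≠ 0 → DisorderDetection.rStar μ p q f0 f1 d w < ∞)) ∧
    -- (a) `τ*` is a stopping time and attains the supremum over all stopping times
    (IsStoppingTime (DisorderDetection.observed X hX)
        (DisorderDetection.tauStar μ p q f0 f1 d X) ∧
      P (DisorderDetection.detection d θ (DisorderDetection.tauStar μ p q f0 f1 d X)) =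
        ⨆ (τ : Ω → ℕ∞) (_ : IsStoppingTime (DisorderDetection.observed X hX) τ),
          P (DisorderDetection.detection d θ τ)) ∧
    -- (b) the optimal value
    P (DisorderDetection.detection d θ (DisorderDetection.tauStar μ p q f0 f1 d X)) =
      (p : ℝ≥0∞) ^ (d + 1) * ∫⁻ y : Fin (d + 1) → E,
        max (DisorderDetection.statistic p q f0 f1 d (Fin.cons (α := fun _ => E) x y))
            (DisorderDetection.rStar μ p q f0 f1 d y) *
          (DisorderDetection.L f0 f1 0 (Fin.cons (α := fun _ => E) x y) : ℝ≥0∞)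
        ∂(Measure.pi fun _ => μ) := by
  exact ⟨fun w => ⟨DisorderDetection.tendsto_threshold_rStar hf0 hf1 hac hp.ne' d w,
      DisorderDetection.rStar_lt_top hf0 hf1 hac hp.ne' hpq d⟩,
    ⟨DisorderDetection.isStoppingTime_tauStar hf0 hf1 hac hp.ne',
      DisorderDetection.measure_detection_tauStar_eq_iSup hf0 hf1 hac hp.ne' hq.ne' hpq hmodel⟩,
    DisorderDetection.measure_detection_tauStar hf0 hf1 hac hp.ne' hq.ne' hpq hmodel hX⟩
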